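/- Let $f_1,\dots,f_n:\mathbb R^d\to\mathbb R\cup\{+\infty\}$ be $\mu$-strongly convex for some $\mu>0$ (that is, $f_i-\frac\mu2\|\cdot\|^2$ is convex), let $\bigcap_i \operatorname{dom} f_i$ have nonempty interior, and put $L=1/\mu$. Consider minimizing $F(\mathbf x)=\sum_i f_i(x_i)$ over $\mathbf x=(x_1,\dots,x_n)\in\mathbb R^{nd}$ with $x_1=\dots=x_n$, with optimal value $F^\star$ and optimal solution $\mathbf x^\star$, and the dual problem of minimizing $D(\mathbf w)=\sum_i d_i(w_i)$ subject to $\sum_i w_i=0$, where $d_i(w)=\sup_x\{\langle w,x\rangle-f_i(x)\}$, with optimal value $D^\star$. Let $\mathcal G^k=(\mathcal V,\mathcal E^k)$, $k\ge0$, be undirected graphs on $\mathcal V=\{1,\dots,n\}$, with neighbor sets $\mathcal N_i^k$, and let $B\ge1$ be an integer such that the union graph $\tilde{\mathcal G}^k=(\mathcal V,\bigcup_{t=k}^{k+B-1}\mathcal E^t)$ is connected for every $k\ge0$. Let $h_{ij}^k=h_{ji}^k$ for $\{i,j\}\in\mathcal E^k$ be weights with $\underline h=\inf_{k}\inf_{\{i,j\}\in\mathcal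 E^k}h_{ij}^k>0$ and $\sum_{j\in\mathcal N_i^k}h_{ij}^k\le1$ for all $i,k$. Let $\beta\in(0,1/L)$, $c_1,c_2>0$, and let $m\ge1$ be an integer. Let $(\mathbf w^k)_{k\ge0}$, $(\mathbf x^k)_{k\ge0}$ be generated by FDGM-AA (the Fenchel dual gradient method with Anderson acceleration and safe-guard): $\sum_i w_i^0=0$ and, for every $k\ge0$ and every node $i$, $x_i^k\in\arg\max_x\{\langle w_i^k,x\rangle-f_i(x)\}$ (so that $\nabla d_i(w_i^k)=x_i^k$) and $$w_i^{k+1}=\Bigl(1-\sum_{j\in\mathcal N_i^k}h_{ij}^k\Bigr)w_i^k+\sum_{j\in\mathcal N_i^k}h_{ij}^k\,w_{ij}^{k+\frac12}.$$ Here, for each edge $\{i,j\}\in\mathcal E^k$, $\mathcal I=\mathcal I_{ij}^k$ is the set of the $m$ most recent times $t\le k$ with $\{i,j\}\in\mathcal E^t$ (all such times if there are fewer than $m$); $(\alpha_{ij},\alpha_{ji})\in\mathbb R^{\mathcal I}\times\mathbb R^{\mathcal I}$ is any minimizer of $\bigl\|\sum_{t\in\mathcal I}\alpha_{ij}^t\nabla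 d_i(w_i^t)-\sum_{t\in\mathcal I}\alpha_{ji}^t\nabla d_j(w_j^t)\bigr\|^2$ subject to $\sum_{t\in\mathcal I}\alpha_{ij}^tw_i^t+\sum_{t\in\mathcal I}\alpha_{ji}^tw_j^t=w_i^k+w_j^k$ and $\sum_{t\in\mathcal I}\alpha_{ij}^t=\sum_{t\in\mathcal I}\alpha_{ji}^t=1$; $$\bar w_{ij}=\sum_{t\in\mathcal I}\alpha_{ij}^tw_i^t-\beta\Bigl(\sum_{t\in\mathcal I}\alpha_{ij}^t\nabla d_i(w_i^t)-\sum_{t\in\mathcal I}\alpha_{ji}^t\nabla d_j(w_j^t)\Bigr),$$ and $\bar w_{ji}$ is given by the same formula with $i$ and $j$ exchanged. If the safe-guard condition $$\langle\nabla d_i(w_i^k),\bar w_{ij}-w_i^k\rangle+\tfrac L2\|\bar w_{ij}-w_i^k\|^2+\langle\nabla d_j(w_j^k),\bar w_{ji}-w_j^k\rangle+\tfrac L2\|\bar w_{ji}-w_j^k\|^2$$ $$\le\min\bigl\{-c_1\|\nabla d_i(w_i^k)-\nabla d_j(w_j^k)\|^2,\,-c_2\bigl(\|\bar w_{ij}-w_i^k\|^2+\|\bar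 w_{ji}-w_j^k\|^2\bigr)\bigr\}$$ holds, then $(w_{ij}^{k+\frac12},w_{ji}^{k+\frac12})=(\bar w_{ij},\bar w_{ji})$; otherwise $w_{ij}^{k+\frac12}=w_i^k-\beta(\nabla d_i(w_i^k)-\nabla d_j(w_j^k))$ and $w_{ji}^{k+\frac12}=w_j^k-\beta(\nabla d_j(w_j^k)-\nabla d_i(w_i^k))$. Put $\theta_1=\min\{\beta(1-\beta L),c_1\}$, $\theta_2=\min\{(1/\beta-L)/2,c_2\}$; let $\tilde\eta$ be the maximum over $t\ge0$ of the maximum degree of $\tilde{\mathcal G}^{tB}$, let $\underline\lambda$ be the infimum over $t\ge0$ of the smallest nonzero eigenvalue of the graph Laplacian of $\tilde{\mathcal G}^{tB}$, and let $$\tau=\frac{3BL^2\tilde\eta}{\theta_2}+\frac{3}{\underline h\,\theta_1}.$$ Then the $d_i$ are finite, $D^\star$ is attained, $F^\star$ and all $F(\mathbf x^k)$ are finite, and $S_0=\{\mathbf w: D(\mathbf w)\le D(\mathbf w^0),\ \sum_iw_i=0\}$ is compact; let $R_0$ be its diameter. For all $k\ge0$, $$D(\mathbf w^k)-D^\star\le\frac{\tau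 R_0^2\,(D(\mathbf w^0)-D^\star)}{\tau R_0^2+\underline\lambda\lfloor k/B\rfloor(D(\mathbf w^0)-D^\star)},$$ $$\|\mathbf x^k-\mathbf x^\star\|\le\sqrt{2L(D(\mathbf w^k)-D^\star)},\qquad |F(\mathbf x^k)-F^\star|\le(R_0+\|\mathbf w^0\|)\sqrt{2L(D(\mathbf w^k)-D^\star)},$$ so that the dual error is $O(1/k)$ and the two primal errors are $O(1/\sqrt k)$ as $k\to\infty$. The bound on $\|\mathbf x^k-\mathbf x^\star\|$ holds for any optimal solution $\mathbf x^\star$; one exists and is unique whenever the suprema defining the $d_i$ are attained at every $w$ (for instance, for lower semicontinuous $f_i$). When the quotient in the first bound has zero denominator, it is read as $0$. -/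

import Mathlib

open scoped InnerProductSpace Asymptotics

noncomputable section

namespace FDGMAA

/-- The decision space `ℝ^d` of one node. -/
abbrev Vec (d : ℕ) := EuclideanSpace ℝ (Fin d)

/-- Stacked vectors `(v₁, …, vₙ) ∈ ℝ^{nd}` with the Euclidean norm. -/
abbrev Stack (n d : ℕ) := PiLp 2 (fun _ : Fin n => Vec d)

/-! ### Objective, conjugates, primal and dual problem -/

/-- Effective domain of an extended-real-valued function. -/
def dom {d : ℕ} (f : Vec d → EReal) : Set (Vec d) := {x | f x ≠ ⊤}

/-- `x` attains `max_y ⟪w, y⟫ - f y`. -/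
def IsConjMaximizer {d : ℕ} (f : Vec d → EReal) (w x : Vec d) : Prop :=
  ∀ y : Vec d, ((⟪w, y⟫_ℝ : ℝ) : EReal) - f y ≤ ((⟪w, x⟫_ℝ : ℝ) : EReal) - f x

/-- The convex conjugate of `f`, with values in the extended reals. -/
def conj {d : ℕ} (f : Vec d → EReal) (w : Vec d) : EReal :=
  ⨆ y : Vec d, ((⟪w, y⟫_ℝ : ℝ) : EReal) - f y

/-- The convex conjugate as a real function (it is finite for the functions considered here). -/
def dual {d : ℕ} (f : Vec d → EReal) (w : Vec d) : ℝ := (conj f w).toReal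

variable {n d : ℕ}

/-- Total objective `F(x) = ∑ i, f_i(x_i)`. -/
def primalObj (f : Fin n → Vec d → EReal) (x : Stack n d) : EReal := ∑ i, f i (x i)

/-- The consensus set `x₁ = … = xₙ`. -/
def consensus (n d : ℕ) : Set (Stack n d) := {x | ∀ i j, x i = x j}

/-- Optimal value `F⋆` of the consensus problem. -/
def primalValue (f : Fin n → Vec d → EReal) : EReal := ⨅ x ∈ consensus n d, primalObj f x

/-- `x` is an optimal solution of the consensus problem. -/
def IsPrimalSolution (f : Fin n → Vec d → EReal) (x : Stack n d) : Prop :=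
  x ∈ consensus n d ∧ ∀ y ∈ consensus n d, primalObj f x ≤ primalObj f y

/-- Dual objective `D(w) = ∑ i, d_i(w_i)`. -/
def dualObj (f : Fin n → Vec d → EReal) (w : Stack n d) : ℝ := ∑ i, dual (f i) (w i)

/-- Dual feasible set `w₁ + … + wₙ = 0`. -/
def dualFeasible (n d : ℕ) : Set (Stack n d) := {w | ∑ i, w i = 0}

/-- Optimal value `D⋆` of the dual problem. -/
def dualValue (f : Fin n → Vec d → EReal) : ℝ := sInf (dualObj f '' dualFeasible n d)

/-- The initial sublevel set `S₀`. -/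
def sublevel (f : Fin n → Vec d → EReal) (w0 : Stack n d) : Set (Stack n d) :=
  {w | dualObj f w ≤ dualObj f w0 ∧ w ∈ dualFeasible n d}

/-- `R₀`, the largest distance between two points of `S₀`. -/
def radius (f : Fin n → Vec d → EReal) (w0 : Stack n d) : ℝ := Metric.diam (sublevel f w0)

/-! ### The algorithm -/

open Classical in
/-- Neighbours of node `i` in the graph `G`. -/
def nbrs (G : SimpleGraph (Fin n)) (i : Fin n) : Finset (Fin n) :=
  Finset.univ.filter fun j => G.Adj i j

open Classical in
/-- The `m` most recent iterations `t ≤ k` at which `i` and `j` communicate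
(all of them if there are fewer than `m`): those followed, up to time `k`, by fewer than `m`
further ones. -/
def history (G : ℕ → SimpleGraph (Fin n)) (m k : ℕ) (i j : Fin n) : Finset ℕ :=
  (Finset.range (k + 1)).filter fun t =>
    (G t).Adj i j ∧
      ((Finset.range (k + 1)).filter fun s => t < s ∧ (G s).Adj i j).card < m

/-- `∇ d_i(w_i^k)`. -/
def dualGrad (f : Fin n → Vec d → EReal) (w : ℕ → Stack n d) (k : ℕ) (i : Fin n) : Vec d :=
  gradient (dual (f i)) (w k i)

/-- The combination `∑ t ∈ I, a_t w_i^t` of past dual iterates of node `i`. -/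
def combIter (w : ℕ → Stack n d) (I : Finset ℕ) (i : Fin n) (a : ℕ → ℝ) : Vec d :=
  ∑ t ∈ I, a t • w t i

/-- The combination `∑ t ∈ I, a_t ∇ d_i(w_i^t)` of past dual gradients of node `i`. -/
def combGrad (f : Fin n → Vec d → EReal) (w : ℕ → Stack n d) (I : Finset ℕ) (i : Fin n)
    (a : ℕ → ℝ) : Vec d :=
  ∑ t ∈ I, a t • dualGrad f w t i

/-- Constraints of the coefficient problem of the edge `{i, j}` at time `k`. -/
def CoeffFeasible (w : ℕ → Stack n d) (I : Finset ℕ) (k : ℕ) (i j : Fin n)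
    (a b : ℕ → ℝ) : Prop :=
  combIter w I i a + combIter w I j b = w k i + w k j ∧ ∑ t ∈ I, a t = 1 ∧ ∑ t ∈ I, b t = 1

/-- `(a, b)` solves the coefficient problem of the edge `{i, j}` at time `k`.  Coefficients are
indexed by all times, but only those in `I` matter. -/
def CoeffOptimal (f : Fin n → Vec d → EReal) (w : ℕ → Stack n d) (I : Finset ℕ) (k : ℕ)
    (i j : Fin n) (a b : ℕ → ℝ) : Prop :=
  CoeffFeasible w I k i j a b ∧
    ∀ a' b' : ℕ → ℝ, CoeffFeasible w I k i j a' b' →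
      ‖combGrad f w I i a - combGrad f w I j b‖ ^ 2 ≤
        ‖combGrad f w I i a' - combGrad f w I j b'‖ ^ 2

/-- The Anderson candidate `w̄_{ij}` of node `i` for its neighbour `j`, from the coefficients
`a` of `i` and `b` of `j`. -/
def candidate (f : Fin n → Vec d → EReal) (w : ℕ → Stack n d) (β : ℝ) (I : Finset ℕ)
    (i j : Fin n) (a b : ℕ → ℝ) : Vec d :=
  combIter w I i a - β • (combGrad f w I i a - combGrad f w I j b)

/-- The plain step `w_i^k - β (∇ d_i(w_i^k) - ∇ d_j(w_j^k))`. -/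
def plainStep (f : Fin n → Vec d → EReal) (w : ℕ → Stack n d) (β : ℝ) (k : ℕ)
    (i j : Fin n) : Vec d :=
  w k i - β • (dualGrad f w k i - dualGrad f w k j)

/-- The safe-guard condition for the candidate pair `(u, v)` of the edge `{i, j}`. -/
def SafeGuard (f : Fin n → Vec d → EReal) (w : ℕ → Stack n d) (L c₁ c₂ : ℝ) (k : ℕ)
    (i j : Fin n) (u v : Vec d) : Prop :=
  ⟪dualGrad f w k i, u - w k i⟫_ℝ + L / 2 * ‖u - w k i‖ ^ 2
      + ⟪dualGrad f w k j, v - w k j⟫_ℝ + L / 2 * ‖v - w k j‖ ^ 2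
    ≤ min (-c₁ * ‖dualGrad f w k i - dualGrad f w k j‖ ^ 2)
        (-c₂ * (‖u - w k i‖ ^ 2 + ‖v - w k j‖ ^ 2))

open Classical in
/-- The intermediate point `w_{ij}^{k+1/2}`, given the coefficients `a` of `i` and `b` of `j`. -/
def halfStep (f : Fin n → Vec d → EReal) (w : ℕ → Stack n d) (β L c₁ c₂ : ℝ)
    (I : Finset ℕ) (k : ℕ) (i j : Fin n) (a b : ℕ → ℝ) : Vec d :=
  if SafeGuard f w L c₁ c₂ k i j (candidate f w β I i j a b) (candidate f w β I j i b a) then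
    candidate f w β I i j a b
  else plainStep f w β k i j

/-- `(w^k)` and `(x^k)` are generated by FDGM-AA on the graphs `G k` with edge weights `h k`,
step-size `β`, smoothness constant `L`, safe-guard constants `c₁, c₂` and memory `m`.
The coefficients `α k i j` of an edge are any solution of its coefficient problem. -/
structure IsRun (f : Fin n → Vec d → EReal) (G : ℕ → SimpleGraph (Fin n))
    (h : ℕ → Fin n → Fin n → ℝ) (β L c₁ c₂ : ℝ) (m : ℕ) (w x : ℕ → Stack n d) : Prop where
  init : ∑ i, w 0 i = 0
  primal : ∀ k i, IsConjMaximizer (f i) (w k i) (x k i)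
  step : ∃ α : ℕ → Fin n → Fin n → ℕ → ℝ,
    (∀ k i j, (G k).Adj i j →
      CoeffOptimal f w (history G m k i j) k i j (α k i j) (α k j i)) ∧
    ∀ k i, w (k + 1) i =
      (1 - ∑ j ∈ nbrs (G k) i, h k i j) • w k i +
        ∑ j ∈ nbrs (G k) i, h k i j •
          halfStep f w β L c₁ c₂ (history G m k i j) k i j (α k i j) (α k j i)

/-! ### Networks and constants -/

/-- The union graph over the times `k, …, k + B - 1`. -/
def unionGraph (G : ℕ → SimpleGraph (Fin n)) (B k : ℕ) : SimpleGraph (Fin n) :=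
  ⨆ t ∈ Set.Ico k (k + B), G t

/-- Infimum `h̲` of all edge weights. -/
def weightInf (G : ℕ → SimpleGraph (Fin n)) (h : ℕ → Fin n → Fin n → ℝ) : ℝ :=
  sInf {r | ∃ k i j, (G k).Adj i j ∧ r = h k i j}

open Classical in
/-- Smallest nonzero eigenvalue of the Laplacian of `G`. -/
def lapMin (G : SimpleGraph (Fin n)) : ℝ :=
  sInf {r | r ≠ 0 ∧ Module.End.HasEigenvalue (Matrix.toLin' (G.lapMatrix ℝ)) r}

/-- `λ̲ = inf_t λ_min` of the Laplacian of the union graph at time `tB`. -/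
def lapInf (G : ℕ → SimpleGraph (Fin n)) (B : ℕ) : ℝ := ⨅ t : ℕ, lapMin (unionGraph G B (t * B))

open Classical in
/-- `η̃ = max_t` of the maximum degree of the union graph at time `tB`. -/
def degMax (G : ℕ → SimpleGraph (Fin n)) (B : ℕ) : ℕ :=
  ⨆ t : ℕ, (unionGraph G B (t * B)).maxDegree

def theta₁ (β L c₁ : ℝ) : ℝ := min (β * (1 - β * L)) c₁

def theta₂ (β L c₂ : ℝ) : ℝ := min ((1 / β - L) / 2) c₂

/-- `τ = 3 B L² η̃ / θ₂ + 3 / (h̲ θ₁)`. -/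
def tau (G : ℕ → SimpleGraph (Fin n)) (h : ℕ → Fin n → Fin n → ℝ) (B : ℕ)
    (β L c₁ c₂ : ℝ) : ℝ :=
  3 * B * L ^ 2 * degMax G B / theta₂ β L c₂ + 3 / (weightInf G h * theta₁ β L c₁)

end FDGMAA

end

/-!
Since each `f i` is `μ`-strongly convex, the conjugates `d i` are finite with `1 / μ`-Lipschitz
gradients, and dual optimality means that the gradient of `D` is constant across the nodes. The
two half steps of an edge preserve the sum of its dual variables, whether the Anderson candidate or
the plain step is taken, and the safe-guard makes `D` decrease by a multiple of both the squared
disagreement of the gradients over the edges and the squared length of the step.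

Over a window of `B` iterations the edges used form a connected graph. The disagreement over this
graph at the start of the window exceeds what the individual steps see only by the drift of the
gradients, which is controlled by the step lengths; so the decrease of `D` over the window bounds
it, and by the spectral gap of the Laplacian it bounds the part of the gradient that is not
constant. By convexity, the dual error `a_t` at the start of window `t` then satisfies
`λ a_t² ≤ τ R² (a_t - a_{t+1})`, where `R` bounds the distance of the iterates to a dual solution;
this gives the `1 / k` rate. Strong convexity of the primal problem turns the dual error into the
two primal errors.
-/

noncomputable section

namespace FDGMAA

section StronglyConcave

open Filter Topology

variable {E : Type*} [NormedAddCommGroup E] [NormedSpace ℝ E]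
  {S : Set E} {φ ψ : E → ℝ} {μ c D M t : ℝ} {a b g z : E}

lemma add_le_of_forall_add_one_sub_mul_le {a b c : ℝ}
    (h : ∀ t ∈ Set.Ioc (0 : ℝ) 1, a + (1 - t) * b ≤ c) : a + b ≤ c := by
  have hlim : Tendsto (fun t : ℝ => a + (1 - t) * b) (𝓝[>] 0) (𝓝 (a + (1 - 0) * b)) :=
    (Continuous.tendsto (by fun_prop) 0).mono_left nhdsWithin_le_nhds
  simpa using le_of_tendsto hlim (mem_of_superset (Ioc_mem_nhdsGT zero_lt_one) h)

lemma norm_sub_sq_le_of_mem_upperBounds (hψ : StrongConcaveOn S μ ψ)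
    (hD : D ∈ upperBounds (ψ '' S)) (ha : a ∈ S) (hb : b ∈ S) :
    μ / 4 * ‖a - b‖ ^ 2 ≤ (D - ψ a) + (D - ψ b) := by
  have hle := hψ.2 ha hb one_half_pos.le one_half_pos.le (add_halves (1 : ℝ))
  have hmax := hD ⟨_, hψ.1 ha hb one_half_pos.le one_half_pos.le (add_halves (1 : ℝ)), rfl⟩
  simp only [smul_eq_mul] at hle
  linarith

lemma cauchySeq_of_tendsto_of_mem_upperBounds (hμ : 0 < μ) (hψ : StrongConcaveOn S μ ψ)
    (hD : D ∈ upperBounds (ψ '' S)) {y : ℕ → E} (hyS : ∀ k, y k ∈ S)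
    (hy : Tendsto (fun k => ψ (y k)) atTop (𝓝 D)) : CauchySeq y := by
  refine Metric.cauchySeq_iff.2 fun ε hε => ?_
  have hev : ∀ᶠ k in atTop, D - μ / 8 * ε ^ 2 < ψ (y k) :=
    hy.eventually (lt_mem_nhds (sub_lt_self D (by positivity)))
  obtain ⟨N, hN⟩ := eventually_atTop.1 hev
  refine ⟨N, fun p hp q hq => ?_⟩
  have hpq := norm_sub_sq_le_of_mem_upperBounds hψ hD (hyS p) (hyS q)
  have hlt : μ / 4 * ‖y p - y q‖ ^ 2 < μ / 4 * ε ^ 2 := by linarith [hN p hp, hN q hq]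
  rw [dist_eq_norm]
  exact lt_of_pow_lt_pow_left₀ 2 hε.le (lt_of_mul_lt_mul_left hlt (by positivity))

-- The supremum of `ψ` need not be attained, as no semicontinuity is assumed; a point `(g, D)` of
-- the closure of the graph serves as a maximizer.
lemma exists_mem_closure_graphOn_of_isLUB [CompleteSpace E] (hμ : 0 < μ)
    (hψ : StrongConcaveOn S μ ψ) (hD : IsLUB (ψ '' S) D) :
    ∃ g, (g, D) ∈ closure (S.graphOn ψ) := by
  obtain ⟨u, -, -, hu, humem⟩ := hD.exists_seq_monotone_tendsto hD.nonempty
  choose y hyS hyu using humem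
  have hy : Tendsto (fun k => ψ (y k)) atTop (𝓝 D) := by simpa only [hyu] using hu
  obtain ⟨g, hg⟩ := cauchySeq_tendsto_of_complete
    (cauchySeq_of_tendsto_of_mem_upperBounds hμ hψ hD.1 hyS hy)
  exact ⟨g, mem_closure_of_tendsto (hg.prodMk_nhds hy)
    (Eventually.of_forall fun k => ⟨y k, hyS k, rfl⟩)⟩

lemma add_norm_sub_sq_le_of_mem_closure_graphOn (hψ : StrongConcaveOn S μ ψ)
    (hD : D ∈ upperBounds (ψ '' S)) (hg : (g, D) ∈ closure (S.graphOn ψ)) (hz : z ∈ S) :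
    ψ z + μ / 2 * ‖g - z‖ ^ 2 ≤ D := by
  refine add_le_of_forall_add_one_sub_mul_le fun t ht => ?_
  have hseg : S.graphOn ψ ⊆
      {p | (1 - t) * p.2 + t * ψ z + (1 - t) * t * (μ / 2 * ‖p.1 - z‖ ^ 2) ≤ D} := by
    rintro _ ⟨y, hy, rfl⟩
    exact (hψ.2 hy hz (sub_nonneg.2 ht.2) ht.1.le (sub_add_cancel 1 t)).trans
      (hD ⟨_, hψ.1 hy hz (sub_nonneg.2 ht.2) ht.1.le (sub_add_cancel 1 t), rfl⟩)
  have hlim : (1 - t) * D + t * ψ z + (1 - t) * t * (μ / 2 * ‖g - z‖ ^ 2) ≤ D :=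
    closure_minimal hseg (isClosed_le (by fun_prop) continuous_const) hg
  refine le_of_mul_le_mul_left ?_ ht.1
  linarith

-- The segment point is a convex combination of a point of `S` near `g` and a point near `z`.
lemma segment_mem_and_le_of_mem_closure_graphOn (hφ : ConvexOn ℝ S φ)
    (hz : ∀ᶠ y in 𝓝 z, y ∈ S ∧ φ y ≤ M) (hg : (g, c) ∈ closure (S.graphOn φ))
    (ht : t ∈ Set.Ioc (0 : ℝ) 1) :
    (1 - t) • g + t • z ∈ S ∧ φ ((1 - t) • g + t • z) ≤ (1 - t) * c + t * M := by
  have hlim : Tendsto (fun p : E × ℝ => z + ((1 - t) / t) • (g - p.1)) (𝓝 (g, c)) (𝓝 z) :=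
    Continuous.tendsto' (by fun_prop) _ _ (by simp)
  have hfreq : ∃ᶠ p in 𝓝 (g, c), (1 - t) • g + t • z ∈ S ∧
      φ ((1 - t) • g + t • z) ≤ (1 - t) * p.2 + t * M := by
    refine ((mem_closure_iff_frequently.1 hg).and_eventually (hlim.eventually hz)).mono ?_
    rintro _ ⟨⟨y, hy, rfl⟩, hzS, hzM⟩
    have hcomb : (1 - t) • g + t • z = (1 - t) • y + t • (z + ((1 - t) / t) • (g - y)) := by
      rw [smul_add, smul_smul, mul_div_cancel₀ _ ht.1.ne', smul_sub]
      abel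
    rw [hcomb]
    refine ⟨hφ.1 hy hzS (sub_nonneg.2 ht.2) ht.1.le (sub_add_cancel 1 t), ?_⟩
    refine (hφ.2 hy hzS (sub_nonneg.2 ht.2) ht.1.le (sub_add_cancel 1 t)).trans ?_
    exact add_le_add_right (mul_le_mul_of_nonneg_left hzM ht.1.le) _
  refine ⟨hfreq.exists.choose_spec.1, ?_⟩
  exact ge_of_tendsto_of_frequently (Continuous.tendsto (by fun_prop) (g, c))
    (hfreq.mono fun _ h => h.2)

end StronglyConcave

section Conjugate

open Filter Topology

variable {E : Type*} [NormedAddCommGroup E] [InnerProductSpace ℝ E]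
  {S : Set E} {φ D : E → ℝ} {μ c M : ℝ} {g v w x y z : E} {K : Submodule ℝ E}

/-- `D` is the convex conjugate of the function that equals `φ` on `S` and `+∞` off `S`; both `φ`
and `D` are real-valued, so finiteness of all the suprema is part of the notion. -/
def IsConjOn (S : Set E) (φ D : E → ℝ) : Prop :=
  ∀ w, IsLUB ((fun y => ⟪w, y⟫_ℝ - φ y) '' S) (D w)

lemma strongConcaveOn_inner_sub (hφ : StrongConvexOn S μ φ) (w : E) :
    StrongConcaveOn S μ fun y => ⟪w, y⟫_ℝ - φ y := by
  refine ⟨hφ.1, fun y hy z hz a b ha hb hab => ?_⟩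
  have hle := hφ.2 hy hz ha hb hab
  simp only [smul_eq_mul, inner_add_right, inner_smul_right] at hle ⊢
  linarith

lemma inner_sub_half_norm_sq_le (hμ : 0 < μ) (v a : E) :
    ⟪v, a⟫_ℝ - μ / 2 * ‖a‖ ^ 2 ≤ 1 / μ / 2 * ‖v‖ ^ 2 := by
  have hsq : 0 ≤ 1 / μ / 2 * (‖v‖ - μ * ‖a‖) ^ 2 := by positivity
  have hexp : 1 / μ / 2 * (‖v‖ - μ * ‖a‖) ^ 2 =
      1 / μ / 2 * ‖v‖ ^ 2 - ‖v‖ * ‖a‖ + μ / 2 * ‖a‖ ^ 2 := by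
    field_simp
    ring
  linarith [real_inner_le_norm v a]

lemma bddAbove_inner_sub_image (hμ : 0 < μ) (hφ : StrongConvexOn S μ φ) (hx : x ∈ S)
    (hmax : ∀ y ∈ S, ⟪v, y⟫_ℝ - φ y ≤ ⟪v, x⟫_ℝ - φ x) (w : E) :
    BddAbove ((fun y => ⟪w, y⟫_ℝ - φ y) '' S) := by
  refine ⟨⟪w, x⟫_ℝ - φ x + 1 / μ / 2 * ‖w - v‖ ^ 2, ?_⟩
  rintro _ ⟨y, hy, rfl⟩
  have hgrowth := add_norm_sub_sq_le_of_mem_closure_graphOn (strongConcaveOn_inner_sub hφ v)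
    (Set.forall_mem_image.2 hmax) (subset_closure ⟨x, hx, rfl⟩) hy
  have hyoung := inner_sub_half_norm_sq_le hμ (w - v) (y - x)
  rw [norm_sub_rev] at hgrowth
  simp only [inner_sub_left, inner_sub_right] at hyoung ⊢
  linarith

lemma IsConjOn.nonempty (hD : IsConjOn S φ D) : S.Nonempty :=
  Set.image_nonempty.1 (hD 0).nonempty

lemma IsConjOn.inner_sub_le (hD : IsConjOn S φ D) (w : E) (hy : y ∈ S) :
    ⟪w, y⟫_ℝ - φ y ≤ D w :=
  (hD w).1 ⟨y, hy, rfl⟩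

lemma IsConjOn.convexOn (hD : IsConjOn S φ D) : ConvexOn ℝ Set.univ D := by
  refine ⟨convex_univ, fun v _ w _ a b ha hb hab => (hD _).2 ?_⟩
  rintro _ ⟨y, hy, rfl⟩
  have hsum := add_le_add (mul_le_mul_of_nonneg_left (hD.inner_sub_le v hy) ha)
    (mul_le_mul_of_nonneg_left (hD.inner_sub_le w hy) hb)
  have hφy : φ y = a * φ y + b * φ y := by rw [← add_mul, hab, one_mul]
  simp only [smul_eq_mul, inner_add_left, real_inner_smul_left]
  linarith

lemma IsConjOn.add_inner_le (hD : IsConjOn S φ D)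
    (hg : (g, D v) ∈ closure (S.graphOn fun y => ⟪v, y⟫_ℝ - φ y)) (w : E) :
    D v + ⟪g, w - v⟫_ℝ ≤ D w := by
  have hgraph : (S.graphOn fun y => ⟪v, y⟫_ℝ - φ y) ⊆ {p | p.2 + ⟪p.1, w - v⟫_ℝ ≤ D w} := by
    rintro _ ⟨y, hy, rfl⟩
    refine le_trans (le_of_eq ?_) (hD.inner_sub_le w hy)
    rw [real_inner_comm, inner_sub_left]
    ring
  exact closure_minimal hgraph (isClosed_le (by fun_prop) continuous_const) hg

lemma IsConjOn.le_add_inner_add_of_mem_closure (hD : IsConjOn S φ D) (hμ : 0 < μ)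
    (hφ : StrongConvexOn S μ φ)
    (hg : (g, D v) ∈ closure (S.graphOn fun y => ⟪v, y⟫_ℝ - φ y)) (w : E) :
    D w ≤ D v + ⟪g, w - v⟫_ℝ + 1 / μ / 2 * ‖w - v‖ ^ 2 := by
  refine (hD w).2 ?_
  rintro _ ⟨y, hy, rfl⟩
  have hgrowth := add_norm_sub_sq_le_of_mem_closure_graphOn (strongConcaveOn_inner_sub hφ v)
    (hD v).1 hg hy
  have hyoung := inner_sub_half_norm_sq_le hμ (w - v) (y - g)
  rw [norm_sub_rev] at hgrowth
  rw [real_inner_comm]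
  simp only [inner_sub_left, inner_sub_right] at hyoung ⊢
  linarith

lemma IsConjOn.inner_add_mul_norm_le (hD : IsConjOn S φ D)
    (hz : ∀ᶠ y in 𝓝 z, y ∈ S ∧ φ y ≤ M) :
    ∃ r > 0, ∀ v, ⟪v, z⟫_ℝ + r * ‖v‖ ≤ D v + M := by
  obtain ⟨r, hr, hball⟩ := Metric.nhds_basis_closedBall.eventually_iff.1 hz
  refine ⟨r, hr, fun v => ?_⟩
  rcases eq_or_ne v 0 with rfl | hv
  · have hzr := hball (Metric.mem_closedBall_self hr.le)
    have hle := hD.inner_sub_le 0 hzr.1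
    simp only [inner_zero_left, norm_zero, mul_zero] at hle ⊢
    linarith [hzr.2]
  · have hv' : ‖v‖ ≠ 0 := norm_ne_zero_iff.2 hv
    have hy := hball (x := z + (r / ‖v‖) • v) (by
      rw [mem_closedBall_iff_norm, add_sub_cancel_left, norm_smul,
        Real.norm_of_nonneg (by positivity), div_mul_cancel₀ _ hv'])
    have hle := hD.inner_sub_le v hy.1
    rw [inner_add_right, inner_smul_right, real_inner_self_eq_norm_sq, pow_two, ← mul_assoc,
      div_mul_cancel₀ _ hv'] at hle
    linarith [hy.2]

lemma IsConjOn.isCompact_sublevel [FiniteDimensional ℝ E] (hD : IsConjOn S φ D)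
    (hz : ∀ᶠ y in 𝓝 z, y ∈ S ∧ φ y ≤ M) (hzK : z ∈ Kᗮ) (c : ℝ) :
    IsCompact {v | D v ≤ c ∧ v ∈ K} := by
  obtain ⟨r, hr, hcoer⟩ := hD.inner_add_mul_norm_le hz
  have hcont : Continuous D := continuousOn_univ.1 (hD.convexOn.continuousOn isOpen_univ)
  have hclosed : IsClosed {v | D v ≤ c ∧ v ∈ K} :=
    (isClosed_le hcont continuous_const).inter K.closed_of_finiteDimensional
  refine Metric.isCompact_of_isClosed_isBounded hclosed
    (isBounded_iff_forall_norm_le.2 ⟨(c + M) / r, fun v hv => ?_⟩)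
  rw [le_div_iff₀ hr]
  have hle := hcoer v
  rw [Submodule.inner_right_of_mem_orthogonal hv.2 hzK] at hle
  linarith [hv.1]

lemma IsConjOn.exists_isMinOn [FiniteDimensional ℝ E] (hD : IsConjOn S φ D)
    (hz : ∀ᶠ y in 𝓝 z, y ∈ S ∧ φ y ≤ M) (hzK : z ∈ Kᗮ) : ∃ v ∈ K, IsMinOn D K v := by
  have hcont : Continuous D := continuousOn_univ.1 (hD.convexOn.continuousOn isOpen_univ)
  obtain ⟨v, hv, hmin⟩ := (hD.isCompact_sublevel hz hzK (D 0)).exists_isMinOn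
    ⟨0, le_rfl, K.zero_mem⟩ hcont.continuousOn
  refine ⟨v, hv.2, fun u hu => ?_⟩
  rcases le_total (D u) (D 0) with h0 | h0
  · exact hmin ⟨h0, hu⟩
  · exact hv.1.trans h0

end Conjugate

section Smooth

open Filter Topology

variable {E : Type*} [NormedAddCommGroup E] [InnerProductSpace ℝ E] [CompleteSpace E]
  {S : Set E} {φ D : E → ℝ} {μ c : ℝ} {g v w x y : E}

lemma hasGradientAt_of_quadratic_bounds (hlo : ∀ v, D w + ⟪g, v - w⟫_ℝ ≤ D v)
    (hup : ∀ v, D v ≤ D w + ⟪g, v - w⟫_ℝ + c * ‖v - w‖ ^ 2) : HasGradientAt D g w := by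
  have hquad : (fun v => D v - D w - ⟪g, v - w⟫_ℝ) =O[𝓝 w] fun v => ‖v - w‖ ^ 2 := by
    refine Asymptotics.IsBigO.of_bound c (Eventually.of_forall fun v => ?_)
    rw [Real.norm_of_nonneg (by linarith [hlo v]), Real.norm_of_nonneg (by positivity)]
    linarith [hup v]
  exact hasGradientAt_iff_isLittleO.2
    (hquad.trans_isLittleO (Asymptotics.isLittleO_pow_sub_sub w one_lt_two))

variable (hμ : 0 < μ) (hφ : StrongConvexOn S μ φ) (hD : IsConjOn S φ D)
include hμ hφ hD

lemma IsConjOn.gradient_mem_closure_graphOn (w : E) :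
    (gradient D w, D w) ∈ closure (S.graphOn fun y => ⟪w, y⟫_ℝ - φ y) := by
  obtain ⟨g, hg⟩ := exists_mem_closure_graphOn_of_isLUB hμ (strongConcaveOn_inner_sub hφ w) (hD w)
  have hgrad : HasGradientAt D g w := hasGradientAt_of_quadratic_bounds (hD.add_inner_le hg)
    (hD.le_add_inner_add_of_mem_closure hμ hφ hg)
  rwa [hgrad.gradient]

lemma IsConjOn.inner_sub_add_norm_sq_le (w : E) (hy : y ∈ S) :
    ⟪w, y⟫_ℝ - φ y + μ / 2 * ‖gradient D w - y‖ ^ 2 ≤ D w :=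
  add_norm_sub_sq_le_of_mem_closure_graphOn (strongConcaveOn_inner_sub hφ w) (hD w).1
    (hD.gradient_mem_closure_graphOn hμ hφ w) hy

lemma IsConjOn.add_inner_gradient_le (v w : E) : D v + ⟪gradient D v, w - v⟫_ℝ ≤ D w :=
  hD.add_inner_le (hD.gradient_mem_closure_graphOn hμ hφ v) w

lemma IsConjOn.le_add_inner_gradient_add (v w : E) :
    D w ≤ D v + ⟪gradient D v, w - v⟫_ℝ + 1 / μ / 2 * ‖w - v‖ ^ 2 :=
  hD.le_add_inner_add_of_mem_closure hμ hφ
    (hD.gradient_mem_closure_graphOn hμ hφ v) w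

lemma IsConjOn.add_inner_gradient_add_norm_sq_le (v w : E) :
    D v + ⟪gradient D v, w - v⟫_ℝ + μ / 2 * ‖gradient D w - gradient D v‖ ^ 2 ≤ D w := by
  have hgraph : (S.graphOn fun y => ⟪v, y⟫_ℝ - φ y) ⊆
      {p | p.2 + ⟪p.1, w - v⟫_ℝ + μ / 2 * ‖gradient D w - p.1‖ ^ 2 ≤ D w} := by
    rintro _ ⟨y, hy, rfl⟩
    refine le_trans (le_of_eq ?_) (hD.inner_sub_add_norm_sq_le hμ hφ w hy)
    rw [real_inner_comm, inner_sub_left]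
    ring
  exact closure_minimal hgraph (isClosed_le (by fun_prop) continuous_const)
    (hD.gradient_mem_closure_graphOn hμ hφ v)

lemma IsConjOn.gradient_eq (hx : x ∈ S) (hxw : D w = ⟪w, x⟫_ℝ - φ x) : gradient D w = x := by
  have hgrowth := hD.inner_sub_add_norm_sq_le hμ hφ w hx
  have hsq : ‖gradient D w - x‖ ^ 2 ≤ 0 :=
    nonpos_of_mul_nonpos_right (by linarith) (half_pos hμ)
  exact sub_eq_zero.1 (norm_eq_zero.1 (sq_nonpos_iff _ |>.1 hsq))

lemma IsConjOn.norm_gradient_sub_le (v w : E) :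
    ‖gradient D v - gradient D w‖ ≤ 1 / μ * ‖v - w‖ := by
  have hvw := hD.add_inner_gradient_add_norm_sq_le hμ hφ v w
  have hwv := hD.add_inner_gradient_add_norm_sq_le hμ hφ w v
  have hcs := real_inner_le_norm (gradient D v - gradient D w) (v - w)
  rw [norm_sub_rev] at hvw
  simp only [inner_sub_left, inner_sub_right] at hvw hwv hcs
  rw [one_div, ← div_eq_inv_mul, le_div_iff₀ hμ]
  rcases (norm_nonneg (gradient D v - gradient D w)).eq_or_lt with h0 | h0
  · rw [← h0, zero_mul]
    exact norm_nonneg _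
  · refine le_of_mul_le_mul_left ?_ h0
    linarith

end Smooth

section PiLp

variable {ι : Type*} [Fintype ι] {E : ι → Type*} [∀ i, NormedAddCommGroup (E i)]
  [∀ i, InnerProductSpace ℝ (E i)] {S : ∀ i, Set (E i)} {φ D : ∀ i, E i → ℝ}

lemma strongConvexOn_sum_piLp {μ : ℝ} (hφ : ∀ i, StrongConvexOn (S i) μ (φ i)) :
    StrongConvexOn {x : PiLp 2 E | ∀ i, x i ∈ S i} μ fun x => ∑ i, φ i (x i) := by
  refine ⟨fun x hx y hy a b ha hb hab i => (hφ i).1 (hx i) (hy i) ha hb hab,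
    fun x hx y hy a b ha hb hab => ?_⟩
  refine (Finset.sum_le_sum fun i _ => (hφ i).2 (hx i) (hy i) ha hb hab).trans (le_of_eq ?_)
  simp only [smul_eq_mul, PiLp.norm_sq_eq_of_L2, Finset.sum_sub_distrib, Finset.sum_add_distrib,
    Finset.mul_sum, WithLp.ofLp_sub, Pi.sub_apply]

lemma isConjOn_sum_piLp (hD : ∀ i, IsConjOn (S i) (φ i) (D i)) :
    IsConjOn {x : PiLp 2 E | ∀ i, x i ∈ S i} (fun x => ∑ i, φ i (x i))
      fun w => ∑ i, D i (w i) := by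
  refine fun w => ⟨?_, fun b hb => ?_⟩
  · rintro _ ⟨y, hy, rfl⟩
    simp only [PiLp.inner_apply, ← Finset.sum_sub_distrib]
    exact Finset.sum_le_sum fun i _ => (hD i).inner_sub_le (w i) (hy i)
  · choose u hu using fun i => (hD i (w i)).exists_seq_monotone_tendsto (hD i (w i)).nonempty
    choose y hyS hyu using fun i => (hu i).2.2.2
    refine le_of_tendsto' (tendsto_finsetSum _ fun i _ => (hu i).2.2.1) fun k => ?_
    refine le_trans (le_of_eq ?_) (hb ⟨WithLp.toLp 2 fun i => y i k, fun i => hyS i k, rfl⟩)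
    simp only [PiLp.inner_apply, ← Finset.sum_sub_distrib, hyu]

end PiLp

section Duality

open Filter Topology

variable {E : Type*} [NormedAddCommGroup E] [InnerProductSpace ℝ E] [CompleteSpace E]
  {S : Set E} {φ D : E → ℝ} {μ r M : ℝ} {v w x z : E} {K : Submodule ℝ E}
  (hμ : 0 < μ) (hφ : StrongConvexOn S μ φ) (hD : IsConjOn S φ D)
include hμ hφ hD

lemma IsConjOn.gradient_mem_orthogonal (hw : w ∈ K) (hmin : IsMinOn D K w) :
    gradient D w ∈ Kᗮ := by
  refine (Submodule.mem_orthogonal' K _).2 fun u hu => ?_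
  have hgrad : HasGradientAt D (gradient D w) w := hasGradientAt_of_quadratic_bounds
    (hD.add_inner_gradient_le hμ hφ w) (hD.le_add_inner_gradient_add hμ hφ w)
  have hline : HasLineDerivAt ℝ D ⟪gradient D w, u⟫_ℝ w u := hgrad.hasFDerivAt.hasLineDerivAt u
  refine IsExtrFilter.hasLineDerivAt_eq_zero (Or.inl hmin) hline (tendsto_principal.2 ?_)
  exact Eventually.of_forall fun t => K.add_mem hw (K.smul_mem t hu)

lemma IsConjOn.neg_add_norm_sq_le (hv : v ∈ K) (hxS : x ∈ S) (hxK : x ∈ Kᗮ) :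
    -D v + μ / 2 * ‖gradient D v - x‖ ^ 2 ≤ φ x := by
  have hgrowth := hD.inner_sub_add_norm_sq_le hμ hφ v hxS
  rw [Submodule.inner_right_of_mem_orthogonal hv hxK] at hgrowth
  linarith

theorem IsConjOn.isGLB_image_inter_orthogonal (hw : w ∈ K) (hmin : IsMinOn D K w)
    (hz : ∀ᶠ y in 𝓝 z, y ∈ S ∧ φ y ≤ M) (hzK : z ∈ Kᗮ) :
    IsGLB (φ '' (S ∩ (Kᗮ : Submodule ℝ E))) (-D w) := by
  refine ⟨?_, fun b hb => ?_⟩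
  · rintro _ ⟨y, ⟨hyS, hyK⟩, rfl⟩
    have hgap := hD.neg_add_norm_sq_le hμ hφ hw hyS hyK
    have hsq : 0 ≤ μ / 2 * ‖gradient D w - y‖ ^ 2 := by positivity
    linarith
  · have hgK := hD.gradient_mem_orthogonal hμ hφ hw hmin
    have hg : (gradient D w, -D w) ∈ closure (S.graphOn φ) := by
      have hmap := map_mem_closure (f := fun p : E × ℝ => (p.1, ⟪w, p.1⟫_ℝ - p.2))
        (t := S.graphOn φ) (by fun_prop) (hD.gradient_mem_closure_graphOn hμ hφ w) (by
          rintro _ ⟨y, hy, rfl⟩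
          exact ⟨y, hy, by simp only [sub_sub_cancel]⟩)
      rwa [Submodule.inner_right_of_mem_orthogonal hw hgK, zero_sub] at hmap
    suffices hsum : (b - M) + (D w + M) ≤ 0 by linarith
    refine add_le_of_forall_add_one_sub_mul_le fun t ht => ?_
    obtain ⟨hpS, hpφ⟩ := segment_mem_and_le_of_mem_closure_graphOn
      (hφ.strictConvexOn hμ).convexOn hz hg ht
    have hbp := hb ⟨_, ⟨hpS, Kᗮ.add_mem (Kᗮ.smul_mem _ hgK) (Kᗮ.smul_mem _ hzK)⟩, rfl⟩
    linarith

lemma IsConjOn.gradient_eq_of_le_neg (hw : w ∈ K) (hxS : x ∈ S) (hxK : x ∈ Kᗮ)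
    (hx : φ x ≤ -D w) : gradient D w = x := by
  have hgap := hD.neg_add_norm_sq_le hμ hφ hw hxS hxK
  have hsq : ‖gradient D w - x‖ ^ 2 ≤ 0 := nonpos_of_mul_nonpos_right (by linarith) (half_pos hμ)
  exact sub_eq_zero.1 (norm_eq_zero.1 (sq_nonpos_iff _ |>.1 hsq))

lemma IsConjOn.norm_gradient_sub_le_sqrt (hw : w ∈ K) (hmin : IsMinOn D K w) (hv : v ∈ K) :
    ‖gradient D v - gradient D w‖ ≤ √(2 * (1 / μ) * (D v - D w)) := by
  refine Real.le_sqrt_of_sq_le ?_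
  have hco := hD.add_inner_gradient_add_norm_sq_le hμ hφ w v
  rw [Submodule.inner_left_of_mem_orthogonal (K.sub_mem hv hw)
    (hD.gradient_mem_orthogonal hμ hφ hw hmin), add_zero] at hco
  calc ‖gradient D v - gradient D w‖ ^ 2
      = 2 * (1 / μ) * (μ / 2 * ‖gradient D v - gradient D w‖ ^ 2) := by field_simp
    _ ≤ 2 * (1 / μ) * (D v - D w) := by gcongr; linarith

theorem IsConjOn.abs_add_le_mul_sqrt (hw : w ∈ K) (hmin : IsMinOn D K w) (hv : v ∈ K)
    (hxS : x ∈ S) (hx : D v = ⟪v, x⟫_ℝ - φ x) (hvr : ‖v‖ ≤ r) (hwr : ‖w‖ ≤ r) :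
    |φ x + D w| ≤ r * √(2 * (1 / μ) * (D v - D w)) := by
  have hgK := hD.gradient_mem_orthogonal hμ hφ hw hmin
  have hdist := hD.norm_gradient_sub_le_sqrt hμ hφ hw hmin hv
  rw [hD.gradient_eq hμ hφ hxS hx] at hdist
  have hinner {u : E} (hu : u ∈ K) (hur : ‖u‖ ≤ r) :
      |⟪u, x⟫_ℝ| ≤ r * √(2 * (1 / μ) * (D v - D w)) := by
    rw [← sub_zero ⟪u, x⟫_ℝ, ← Submodule.inner_right_of_mem_orthogonal hu hgK, ← inner_sub_right]
    exact (abs_real_inner_le_norm _ _).trans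
      (mul_le_mul hur hdist (norm_nonneg _) ((norm_nonneg u).trans hur))
  have hupper := (abs_le.1 (hinner hv hvr)).2
  have hlower := (abs_le.1 (hinner hw hwr)).1
  have hgap : D w ≤ D v := hmin hv
  have hconj := hD.inner_sub_le w hxS
  exact abs_le.2 ⟨by linarith, by linarith⟩

lemma IsConjOn.sub_le_norm_starProjection_mul [K.HasOrthogonalProjection] (hv : v ∈ K)
    (hw : w ∈ K) : D v - D w ≤ ‖K.starProjection (gradient D v)‖ * ‖v - w‖ := by
  have hlower := hD.add_inner_gradient_le hμ hφ v w
  have hproj : ⟪K.starProjection (gradient D v), v - w⟫_ℝ = ⟪gradient D v, v - w⟫_ℝ := by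
    rw [K.inner_starProjection_left_eq_right,
      Submodule.starProjection_eq_self_iff.2 (K.sub_mem hv hw)]
  have hcs := real_inner_le_norm (K.starProjection (gradient D v)) (v - w)
  rw [hproj] at hcs
  rw [← neg_sub v w, inner_neg_right] at hlower
  linarith

end Duality

section ExtendedReal

variable {d : ℕ} {f : Vec d → EReal} {w x : Vec d} {μ D : ℝ}

lemma coe_inner_sub_of_notMem_dom (w : Vec d) (hx : x ∉ dom f) :
    ((⟪w, x⟫_ℝ : ℝ) : EReal) - f x = ⊥ := by
  rw [not_not.1 hx, EReal.sub_top]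

lemma coe_inner_sub_of_mem_dom (hbot : ∀ x, f x ≠ ⊥) (w : Vec d) (hx : x ∈ dom f) :
    ((⟪w, x⟫_ℝ : ℝ) : EReal) - f x = ((⟪w, x⟫_ℝ - (f x).toReal : ℝ) : EReal) := by
  rw [EReal.coe_sub, EReal.coe_toReal hx (hbot x)]

lemma IsConjMaximizer.mem_dom (hbot : ∀ x, f x ≠ ⊥) (hne : (dom f).Nonempty)
    (hx : IsConjMaximizer f w x) : x ∈ dom f := by
  by_contra hxd
  obtain ⟨y, hy⟩ := hne
  have hle := hx y
  rw [coe_inner_sub_of_notMem_dom w hxd, coe_inner_sub_of_mem_dom hbot w hy, le_bot_iff] at hle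
  exact EReal.coe_ne_bot _ hle

lemma IsConjMaximizer.inner_sub_toReal_le (hbot : ∀ x, f x ≠ ⊥) (hx : IsConjMaximizer f w x)
    {y : Vec d} (hy : y ∈ dom f) : ⟪w, y⟫_ℝ - (f y).toReal ≤ ⟪w, x⟫_ℝ - (f x).toReal := by
  have hle := hx y
  rw [coe_inner_sub_of_mem_dom hbot w (hx.mem_dom hbot ⟨y, hy⟩),
    coe_inner_sub_of_mem_dom hbot w hy] at hle
  exact EReal.coe_le_coe_iff.1 hle

lemma conj_eq_coe_of_isLUB (hbot : ∀ x, f x ≠ ⊥)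
    (hD : IsLUB ((fun y => ⟪w, y⟫_ℝ - (f y).toReal) '' dom f) D) : conj f w = D := by
  refine le_antisymm (iSup_le fun y => ?_) (EReal.le_of_forall_lt_iff_le.1 fun c hc => ?_)
  · by_cases hy : y ∈ dom f
    · rw [coe_inner_sub_of_mem_dom hbot w hy]
      exact EReal.coe_le_coe_iff.2 (hD.1 ⟨y, hy, rfl⟩)
    · rw [coe_inner_sub_of_notMem_dom w hy]
      exact bot_le
  · refine EReal.coe_le_coe_iff.2 (hD.2 ?_)
    rintro _ ⟨y, hy, rfl⟩
    rw [← EReal.coe_le_coe_iff, ← coe_inner_sub_of_mem_dom hbot w hy]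
    exact (le_iSup (fun y => ((⟪w, y⟫_ℝ : ℝ) : EReal) - f y) y).trans hc.le

lemma isConjOn_dual (hbot : ∀ x, f x ≠ ⊥) (hμ : 0 < μ)
    (hf : StrongConvexOn (dom f) μ fun x => (f x).toReal) (hne : (dom f).Nonempty)
    (hx : IsConjMaximizer f w x) : IsConjOn (dom f) (fun x => (f x).toReal) (dual f) := by
  intro v
  have hlub := isLUB_csSup (hne.image _) (bddAbove_inner_sub_image hμ hf (hx.mem_dom hbot hne)
    (fun y hy => hx.inner_sub_toReal_le hbot hy) v)
  rwa [dual, conj_eq_coe_of_isLUB hbot hlub, EReal.toReal_coe]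

lemma IsConjOn.conj_eq_coe_dual (hbot : ∀ x, f x ≠ ⊥)
    (hD : IsConjOn (dom f) (fun x => (f x).toReal) (dual f)) (v : Vec d) :
    conj f v = (dual f v : EReal) :=
  conj_eq_coe_of_isLUB hbot (hD v)

lemma IsConjOn.dual_eq (hbot : ∀ x, f x ≠ ⊥)
    (hD : IsConjOn (dom f) (fun x => (f x).toReal) (dual f)) (hx : IsConjMaximizer f w x) :
    dual f w = ⟪w, x⟫_ℝ - (f x).toReal := by
  refine (hD w).unique ⟨?_, fun b hb => hb ⟨x, hx.mem_dom hbot hD.nonempty, rfl⟩⟩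
  rintro _ ⟨y, hy, rfl⟩
  exact hx.inner_sub_toReal_le hbot hy

end ExtendedReal

section Consensus

open Filter Topology

variable {n d : ℕ}

/-- The dual feasible set as a subspace of `ℝ^{nd}`. -/
def dualSubspace (n d : ℕ) : Submodule ℝ (Stack n d) where
  carrier := dualFeasible n d
  zero_mem' := by simp [dualFeasible]
  add_mem' {v w} hv hw := by
    have hv' : ∑ i, v i = 0 := hv
    have hw' : ∑ i, w i = 0 := hw
    simp [dualFeasible, Finset.sum_add_distrib, hv', hw']
  smul_mem' c v hv := by
    have hv' : ∑ i, v i = 0 := hv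
    simp [dualFeasible, ← Finset.smul_sum, hv']

lemma inner_piLpSingle_left {ι : Type*} [Fintype ι] [DecidableEq ι] {E : Type*}
    [NormedAddCommGroup E] [InnerProductSpace ℝ E] (i : ι) (u : E) (x : PiLp 2 fun _ : ι => E) :
    ⟪PiLp.single 2 i u, x⟫_ℝ = ⟪u, x i⟫_ℝ := by
  rw [PiLp.inner_apply, Finset.sum_eq_single_of_mem i (Finset.mem_univ i) fun j _ hj => ?_]
  · rw [PiLp.single_eq_same]
  · rw [PiLp.single_eq_of_ne _ hj, inner_zero_left]

lemma coe_dualSubspace_orthogonal : ((dualSubspace n d)ᗮ : Set (Stack n d)) = consensus n d := by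
  ext x
  refine ⟨fun hx i j => ?_, fun hx => (Submodule.mem_orthogonal _ x).2 fun w hw => ?_⟩
  · set e : Stack n d := PiLp.single 2 i (x i - x j) - PiLp.single 2 j (x i - x j) with he
    have hemem : e ∈ dualSubspace n d := by
      change ∑ l, e l = 0
      simp [he, Finset.sum_sub_distrib]
    have hortho := Submodule.inner_right_of_mem_orthogonal hemem hx
    rw [he, inner_sub_left, inner_piLpSingle_left, inner_piLpSingle_left, ← inner_sub_right,
      inner_self_eq_zero] at hortho
    exact sub_eq_zero.1 hortho
  · have hw' : ∑ i, w i = 0 := hw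
    rcases isEmpty_or_nonempty (Fin n) with _ | ⟨⟨i⟩⟩
    · simp [PiLp.inner_apply]
    · rw [PiLp.inner_apply, Finset.sum_congr rfl fun j _ => by rw [hx j i], ← sum_inner, hw',
        inner_zero_left]

/-- The effective domain of the total objective `F`. -/
def domain (f : Fin n → Vec d → EReal) : Set (Stack n d) := {x | ∀ i, x i ∈ dom (f i)}

/-- The total objective as a real function, meaningful on `domain f` only. -/
def realObj (f : Fin n → Vec d → EReal) (x : Stack n d) : ℝ := ∑ i, (f i (x i)).toReal

variable {f : Fin n → Vec d → EReal} {w x : Stack n d} {μ F : ℝ}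

lemma strongConvexOn_realObj
    (hf : ∀ i, StrongConvexOn (dom (f i)) μ fun x => (f i x).toReal) :
    StrongConvexOn (domain f) μ (realObj f) :=
  strongConvexOn_sum_piLp hf

lemma isConjOn_dualObj
    (hD : ∀ i, IsConjOn (dom (f i)) (fun x => (f i x).toReal) (dual (f i))) :
    IsConjOn (domain f) (realObj f) (dualObj f) :=
  isConjOn_sum_piLp hD

lemma mem_domain_of_isConjMaximizer (hbot : ∀ i x, f i x ≠ ⊥)
    (hD : ∀ i, IsConjOn (dom (f i)) (fun x => (f i x).toReal) (dual (f i)))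
    (hx : ∀ i, IsConjMaximizer (f i) (w i) (x i)) : x ∈ domain f :=
  fun i => (hx i).mem_dom (hbot i) (hD i).nonempty

lemma primalObj_eq_coe_realObj (hbot : ∀ i x, f i x ≠ ⊥) (hx : x ∈ domain f) :
    primalObj f x = (realObj f x : EReal) := by
  let coeHom : ℝ →+ EReal := ⟨⟨Real.toEReal, EReal.coe_zero⟩, EReal.coe_add⟩
  rw [realObj, show ((∑ i, (f i (x i)).toReal : ℝ) : EReal) = _ from map_sum coeHom _ _]
  exact Finset.sum_congr rfl fun i _ => (EReal.coe_toReal (hx i) (hbot i _)).symm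

lemma mem_domain_of_primalObj_ne_top (hbot : ∀ i x, f i x ≠ ⊥) (hx : primalObj f x ≠ ⊤) :
    x ∈ domain f := by
  intro i hi
  have hrest : ∑ j ∈ Finset.univ.erase i, f j (x j) ≠ ⊥ :=
    Finset.sum_induction _ (· ≠ ⊥) (fun _ _ ha hb => EReal.add_ne_bot_iff.2 ⟨ha, hb⟩)
      EReal.zero_ne_bot fun j _ => hbot j _
  rw [primalObj, ← Finset.add_sum_erase _ _ (Finset.mem_univ i), hi,
    EReal.top_add_of_ne_bot hrest] at hx
  exact hx rfl

lemma primalValue_eq_coe_of_isGLB (hbot : ∀ i x, f i x ≠ ⊥)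
    (hF : IsGLB (realObj f '' (domain f ∩ consensus n d)) F) : primalValue f = F := by
  refine le_antisymm (EReal.ge_of_forall_gt_iff_ge.1 fun c hc => ?_) (le_iInf₂ fun y hy => ?_)
  · refine EReal.coe_le_coe_iff.2 (hF.2 ?_)
    rintro _ ⟨y, ⟨hyf, hy⟩, rfl⟩
    rw [← EReal.coe_le_coe_iff, ← primalObj_eq_coe_realObj hbot hyf]
    exact hc.le.trans (iInf₂_le y hy)
  · by_cases hyf : primalObj f y = ⊤
    · exact hyf ▸ le_top
    · have hyd := mem_domain_of_primalObj_ne_top hbot hyf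
      rw [primalObj_eq_coe_realObj hbot hyd]
      exact EReal.coe_le_coe_iff.2 (hF.1 ⟨y, ⟨hyd, hy⟩, rfl⟩)

lemma isPrimalSolution_iff (hbot : ∀ i x, f i x ≠ ⊥)
    (hF : IsGLB (realObj f '' (domain f ∩ consensus n d)) F) :
    IsPrimalSolution f x ↔ x ∈ domain f ∧ x ∈ consensus n d ∧ realObj f x ≤ F := by
  have hvalue : IsPrimalSolution f x ↔ x ∈ consensus n d ∧ primalObj f x ≤ F := by
    rw [← primalValue_eq_coe_of_isGLB hbot hF, primalValue, le_iInf₂_iff, IsPrimalSolution]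
  rw [hvalue]
  refine ⟨fun ⟨hx, hle⟩ => ?_, fun ⟨hxf, hx, hle⟩ => ⟨hx, ?_⟩⟩
  · have hxf := mem_domain_of_primalObj_ne_top hbot (hle.trans_lt (EReal.coe_lt_top F)).ne
    exact ⟨hxf, hx, EReal.coe_le_coe_iff.1 (primalObj_eq_coe_realObj hbot hxf ▸ hle)⟩
  · rw [primalObj_eq_coe_realObj hbot hxf]
    exact EReal.coe_le_coe_iff.2 hle

lemma dualObj_eq_inner_sub (hbot : ∀ i x, f i x ≠ ⊥)
    (hD : ∀ i, IsConjOn (dom (f i)) (fun x => (f i x).toReal) (dual (f i)))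
    (hx : ∀ i, IsConjMaximizer (f i) (w i) (x i)) : dualObj f w = ⟪w, x⟫_ℝ - realObj f x := by
  rw [PiLp.inner_apply, realObj, ← Finset.sum_sub_distrib]
  exact Finset.sum_congr rfl fun i _ => (hD i).dual_eq (hbot i) (hx i)

lemma exists_eventually_mem_domain_and_le (hf : ConvexOn ℝ (domain f) (realObj f))
    (hint : (interior (⋂ i, dom (f i))).Nonempty) :
    ∃ z ∈ consensus n d, ∃ M, ∀ᶠ y in 𝓝 z, y ∈ domain f ∧ realObj f y ≤ M := by
  obtain ⟨p, hp⟩ := hint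
  set z : Stack n d := WithLp.toLp 2 fun _ => p
  have hdom : domain f ∈ 𝓝 z := by
    have hnode : ∀ᶠ y in 𝓝 z, ∀ i, y i ∈ ⋂ j, dom (f j) := eventually_all.2 fun i =>
      ((PiLp.continuous_apply 2 _ i).tendsto z).eventually_mem (mem_interior_iff_mem_nhds.1 hp)
    exact hnode.mono fun y hy i => Set.mem_iInter.1 (hy i) i
  have hcont : ContinuousAt (realObj f) z :=
    hf.continuousOn_interior.continuousAt (interior_mem_nhds.2 hdom)
  exact ⟨z, fun _ _ => rfl, realObj f z + 1, Eventually.and hdom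
    ((hcont.eventually_lt continuousAt_const (lt_add_one _)).mono fun _ => le_of_lt)⟩

end Consensus

section SpectralGap

variable {n d : ℕ}

lemma mul_norm_sq_le_inner_of_mem_ker_orthogonal {E : Type*} [NormedAddCommGroup E]
    [InnerProductSpace ℝ E] [FiniteDimensional ℝ E] {T : E →ₗ[ℝ] E} {c : ℝ} {v : E}
    (hT : T.IsSymmetric) (hc : ∀ r ≠ 0, Module.End.HasEigenvalue T r → c ≤ r)
    (hv : v ∈ (LinearMap.ker T)ᗮ) : c * ‖v‖ ^ 2 ≤ ⟪v, T v⟫_ℝ := by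
  set e := hT.eigenvectorBasis rfl
  set r := hT.eigenvalues rfl
  have hTe (i) : T (e i) = r i • e i := hT.apply_eigenvectorBasis rfl i
  have hquad : ⟪v, T v⟫_ℝ = ∑ i, r i * ⟪e i, v⟫_ℝ ^ 2 := by
    rw [← e.sum_inner_mul_inner]
    refine Finset.sum_congr rfl fun i _ => ?_
    rw [← hT, hTe, real_inner_smul_left, real_inner_comm (e i)]
    ring
  have hnorm : ‖v‖ ^ 2 = ∑ i, ⟪e i, v⟫_ℝ ^ 2 := by
    simp only [← e.sum_sq_norm_inner_right v, Real.norm_eq_abs, sq_abs]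
  rw [hquad, hnorm, Finset.mul_sum]
  refine Finset.sum_le_sum fun i _ => ?_
  by_cases hi : r i = 0
  · have hker : e i ∈ LinearMap.ker T := by rw [LinearMap.mem_ker, hTe, hi, zero_smul]
    rw [Submodule.inner_right_of_mem_orthogonal hker hv]
    simp
  · exact mul_le_mul_of_nonneg_right (hc _ hi (hT.hasEigenvalue_eigenvalues rfl i)) (sq_nonneg _)

/-- The Dirichlet energy of a vector-valued function on the nodes, that is, the quadratic form of
the graph Laplacian.  Every edge is met twice in the double sum, hence the factor `1 / 2`. -/
def dirichletEnergy {E : Type*} [SeminormedAddCommGroup E] (G : SimpleGraph (Fin n))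
    (y : Fin n → E) : ℝ :=
  (∑ i, ∑ j ∈ nbrs G i, ‖y i - y j‖ ^ 2) / 2

variable {G : SimpleGraph (Fin n)}

open Classical in
lemma inner_toEuclideanLin_lapMatrix (G : SimpleGraph (Fin n)) (v : EuclideanSpace ℝ (Fin n)) :
    ⟪v, (G.lapMatrix ℝ).toEuclideanLin v⟫_ℝ = dirichletEnergy G v := by
  have hform := SimpleGraph.lapMatrix_toLinearMap₂' (R := ℝ) G v.ofLp
  rw [Matrix.toLinearMap₂'_apply'] at hform
  rw [real_inner_comm]
  refine hform.trans ?_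
  simp only [dirichletEnergy, nbrs, Finset.sum_filter, Real.norm_eq_abs, sq_abs]

open Classical in
lemma lapMin_eq_sInf_spectrum_diff (G : SimpleGraph (Fin n)) :
    lapMin G = sInf (spectrum ℝ (G.lapMatrix ℝ) \ {0}) := by
  rw [lapMin]
  congr 1
  ext r
  rw [Set.mem_sdiff, Set.mem_singleton_iff, ← Matrix.spectrum_toLin',
    ← Module.End.hasEigenvalue_iff_mem_spectrum]
  exact and_comm

open Classical in
lemma nonneg_of_mem_spectrum_lapMatrix {r : ℝ} (hr : r ∈ spectrum ℝ (G.lapMatrix ℝ)) : 0 ≤ r := by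
  rw [(G.isHermitian_lapMatrix ℝ).spectrum_real_eq_range_eigenvalues] at hr
  obtain ⟨i, rfl⟩ := hr
  exact (G.posSemidef_lapMatrix ℝ).eigenvalues_nonneg i

lemma lapMin_mul_norm_sq_le (hG : G.Connected) {v : EuclideanSpace ℝ (Fin n)}
    (hv : ∑ i, v i = 0) : lapMin G * ‖v‖ ^ 2 ≤ dirichletEnergy G v := by
  classical
  have hsymm : (G.lapMatrix ℝ).toEuclideanLin.IsSymmetric :=
    Matrix.isSymmetric_toEuclideanLin_iff.2 (G.isHermitian_lapMatrix ℝ)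
  rw [← inner_toEuclideanLin_lapMatrix]
  refine mul_norm_sq_le_inner_of_mem_ker_orthogonal hsymm (fun r hr0 hr => ?_)
    ((Submodule.mem_orthogonal _ v).2 fun u hu => ?_)
  · rw [Module.End.hasEigenvalue_iff_mem_spectrum, Matrix.spectrum_toLpLin] at hr
    rw [lapMin_eq_sInf_spectrum_diff]
    exact csInf_le ⟨0, fun s hs => nonneg_of_mem_spectrum_lapMatrix hs.1⟩ ⟨hr, hr0⟩
  · have hconst := (SimpleGraph.lapMatrix_mulVec_eq_zero_iff_forall_reachable G (x := u.ofLp)).1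
      (congrArg WithLp.ofLp (LinearMap.mem_ker.1 hu))
    obtain ⟨j⟩ := hG.nonempty
    rw [PiLp.inner_apply, Finset.sum_congr rfl fun i _ => by rw [hconst i j (hG.preconnected i j)],
      ← inner_sum, hv, inner_zero_right]

lemma lapMin_pos (hG : G.Connected) (hn : 2 ≤ n) : 0 < lapMin G := by
  classical
  have hA := G.isHermitian_lapMatrix ℝ
  have hfin : (spectrum ℝ (G.lapMatrix ℝ) \ {0}).Finite := by
    rw [hA.spectrum_real_eq_range_eigenvalues]
    exact (Set.finite_range _).sdiff
  have hne : (spectrum ℝ (G.lapMatrix ℝ) \ {0}).Nonempty := by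
    by_contra hempty
    have hzero : G.lapMatrix ℝ = 0 := hA.eigenvalues_eq_zero_iff.1 <| funext fun i => by
      by_contra hi
      exact hempty ⟨_, hA.spectrum_real_eq_range_eigenvalues ▸ ⟨i, rfl⟩, hi⟩
    have hconst := (SimpleGraph.lapMatrix_mulVec_eq_zero_iff_forall_reachable G
      (x := fun i : Fin n => (i : ℝ))).1 (by rw [hzero, Matrix.zero_mulVec])
    have h01 := hconst ⟨0, by omega⟩ ⟨1, by omega⟩ (hG.preconnected _ _)
    norm_num at h01
  have hmem := hne.csInf_mem hfin
  rw [← lapMin_eq_sInf_spectrum_diff] at hmem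
  exact (nonneg_of_mem_spectrum_lapMatrix hmem.1).lt_of_ne (Ne.symm hmem.2)

lemma finite_range_lapMin_comp {ι : Type*} (G : ι → SimpleGraph (Fin n)) :
    (Set.range fun t => lapMin (G t)).Finite :=
  (Set.finite_range (lapMin (n := n))).subset (Set.range_comp_subset_range G lapMin)

lemma lapInf_pos {G : ℕ → SimpleGraph (Fin n)} {B : ℕ}
    (hconn : ∀ t, (unionGraph G B (t * B)).Connected) (hn : 2 ≤ n) : 0 < lapInf G B := by
  obtain ⟨t, ht⟩ := (Set.range_nonempty _).csInf_mem
    (finite_range_lapMin_comp fun t => unionGraph G B (t * B))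
  rw [lapInf, iInf, ← ht]
  exact lapMin_pos (hconn t) hn

lemma lapInf_le_lapMin (G : ℕ → SimpleGraph (Fin n)) (B t : ℕ) :
    lapInf G B ≤ lapMin (unionGraph G B (t * B)) :=
  ciInf_le (finite_range_lapMin_comp fun t => unionGraph G B (t * B)).bddBelow t

lemma dirichletEnergy_eq_sum_apply (G : SimpleGraph (Fin n)) (y : Fin n → Vec d) :
    dirichletEnergy G y = ∑ a, dirichletEnergy G fun i => y i a := by
  simp only [dirichletEnergy, ← Finset.sum_div, EuclideanSpace.norm_sq_eq]
  rw [Finset.sum_comm]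
  simp only [Finset.sum_comm (s := (Finset.univ : Finset (Fin d))), PiLp.sub_apply]

lemma lapMin_mul_norm_sq_le_of_mem_dualSubspace (hG : G.Connected) {y : Stack n d}
    (hy : y ∈ dualSubspace n d) : lapMin G * ‖y‖ ^ 2 ≤ dirichletEnergy G y := by
  have hy' : ∑ i, y i = 0 := hy
  rw [dirichletEnergy_eq_sum_apply]
  calc lapMin G * ‖y‖ ^ 2 = ∑ a, lapMin G * ‖WithLp.toLp 2 fun i => y i a‖ ^ 2 := by
        simp only [← Finset.mul_sum, PiLp.norm_sq_eq_of_L2]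
        rw [Finset.sum_comm]
    _ ≤ ∑ a, dirichletEnergy G fun i => y i a := Finset.sum_le_sum fun a _ =>
        lapMin_mul_norm_sq_le hG <| by
          simpa using congrArg (fun u : Vec d => u a) hy'

lemma lapMin_mul_norm_starProjection_sq_le (hG : G.Connected) (y : Stack n d) :
    lapMin G * ‖(dualSubspace n d).starProjection y‖ ^ 2 ≤ dirichletEnergy G y := by
  have hmean : y - (dualSubspace n d).starProjection y ∈ consensus n d :=
    coe_dualSubspace_orthogonal ▸ Submodule.sub_starProjection_mem_orthogonal y
  have hdiff (i j) : (dualSubspace n d).starProjection y i -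
      (dualSubspace n d).starProjection y j = y i - y j := by
    have hij : y i - (dualSubspace n d).starProjection y i =
      y j - (dualSubspace n d).starProjection y j := hmean i j
    rw [← sub_eq_zero] at hij ⊢
    rw [← neg_eq_zero, ← hij]
    abel
  have hmem : (dualSubspace n d).starProjection y ∈ dualSubspace n d :=
    Submodule.starProjection_apply_mem _ y
  refine (lapMin_mul_norm_sq_le_of_mem_dualSubspace hG hmem).trans (le_of_eq ?_)
  simp only [dirichletEnergy, hdiff]

end SpectralGap

section Algorithm

variable {n d m k : ℕ} {f : Fin n → Vec d → EReal} {G : ℕ → SimpleGraph (Fin n)}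
  {h : ℕ → Fin n → Fin n → ℝ} {β L c₁ c₂ θ₁ θ₂ : ℝ} {w x : ℕ → Stack n d} {I : Finset ℕ}
  {i j : Fin n} {a b : ℕ → ℝ} {u v : Vec d}

/-- `(w^k)` and `(x^k)` are generated by the weighted averaging scheme of FDGM-AA when the
intermediate points of an edge are an arbitrary exchange between its two ends, preserving the sum
of the two dual variables and passing the safe-guard with constants `θ₁, θ₂`. -/
structure IsSafeGuardedRun (f : Fin n → Vec d → EReal) (G : ℕ → SimpleGraph (Fin n))
    (h : ℕ → Fin n → Fin n → ℝ) (L θ₁ θ₂ : ℝ) (w x : ℕ → Stack n d) : Prop where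
  init : ∑ i, w 0 i = 0
  primal : ∀ k i, IsConjMaximizer (f i) (w k i) (x k i)
  step : ∃ u : ℕ → Fin n → Fin n → Vec d,
    (∀ k i j, (G k).Adj i j → u k i j + u k j i = w k i + w k j ∧
      SafeGuard f w L θ₁ θ₂ k i j (u k i j) (u k j i)) ∧
    ∀ k i, w (k + 1) i =
      (1 - ∑ j ∈ nbrs (G k) i, h k i j) • w k i + ∑ j ∈ nbrs (G k) i, h k i j • u k i j

lemma history_comm (G : ℕ → SimpleGraph (Fin n)) (m k : ℕ) (i j : Fin n) :
    history G m k i j = history G m k j i := by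
  classical
  have h : (fun t => (G t).Adj i j) = fun t => (G t).Adj j i :=
    funext fun t => propext ((G t).adj_comm i j)
  exact congrArg (fun P : ℕ → Prop => (Finset.range (k + 1)).filter fun t =>
    P t ∧ ((Finset.range (k + 1)).filter fun s => t < s ∧ P s).card < m) h

lemma candidate_add_candidate (hab : CoeffFeasible w I k i j a b) (β : ℝ) :
    candidate f w β I i j a b + candidate f w β I j i b a = w k i + w k j := by
  rw [← hab.1, candidate, candidate, smul_sub, smul_sub]
  abel

lemma plainStep_add_plainStep (f : Fin n → Vec d → EReal) (w : ℕ → Stack n d) (β : ℝ) (k : ℕ)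
    (i j : Fin n) : plainStep f w β k i j + plainStep f w β k j i = w k i + w k j := by
  rw [plainStep, plainStep, smul_sub, smul_sub]
  abel

lemma safeGuard_comm : SafeGuard f w L c₁ c₂ k i j u v ↔ SafeGuard f w L c₁ c₂ k j i v u := by
  rw [SafeGuard, SafeGuard, norm_sub_rev (dualGrad f w k i), add_comm (‖u - w k i‖ ^ 2), add_assoc,
    add_comm (⟪dualGrad f w k i, u - w k i⟫_ℝ + _), ← add_assoc]

lemma SafeGuard.mono (hsg : SafeGuard f w L c₁ c₂ k i j u v) (h₁ : θ₁ ≤ c₁) (h₂ : θ₂ ≤ c₂) :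
    SafeGuard f w L θ₁ θ₂ k i j u v :=
  hsg.trans (min_le_min (by gcongr) (by gcongr))

lemma safeGuard_plainStep (hβ : β ≠ 0) (L : ℝ) :
    SafeGuard f w L (β * (1 - β * L)) ((1 / β - L) / 2) k i j
      (plainStep f w β k i j) (plainStep f w β k j i) := by
  set δ := dualGrad f w k i - dualGrad f w k j with hδ
  have hu : plainStep f w β k i j - w k i = -(β • δ) := by rw [plainStep]; abel
  have hv : plainStep f w β k j i - w k j = β • δ := by
    rw [plainStep, hδ, ← neg_sub (dualGrad f w k i), smul_neg]; abel
  have hinner : ⟪dualGrad f w k i, δ⟫_ℝ - ⟪dualGrad f w k j, δ⟫_ℝ = ‖δ‖ ^ 2 := by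
    rw [← inner_sub_left, ← hδ, real_inner_self_eq_norm_sq]
  rw [SafeGuard, hu, hv, ← hδ, inner_neg_right, real_inner_smul_right, real_inner_smul_right,
    norm_neg, norm_smul, mul_pow, Real.norm_eq_abs, sq_abs]
  refine le_min (le_of_eq ?_) (le_of_eq ?_)
  · linear_combination -β * hinner
  · field_simp
    linear_combination -(2 : ℝ) * hinner

lemma halfStep_exchange (hβ : 0 < β) (hab : CoeffFeasible w I k i j a b) (L c₁ c₂ : ℝ) :
    halfStep f w β L c₁ c₂ I k i j a b + halfStep f w β L c₁ c₂ I k j i b a = w k i + w k j ∧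
      SafeGuard f w L (theta₁ β L c₁) (theta₂ β L c₂) k i j
        (halfStep f w β L c₁ c₂ I k i j a b) (halfStep f w β L c₁ c₂ I k j i b a) := by
  rw [halfStep, halfStep, safeGuard_comm (i := j)]
  split_ifs with hsg
  · exact ⟨candidate_add_candidate hab β, hsg.mono (min_le_right _ _) (min_le_right _ _)⟩
  · exact ⟨plainStep_add_plainStep f w β k i j,
      (safeGuard_plainStep hβ.ne' L).mono (min_le_left _ _) (min_le_left _ _)⟩

lemma IsRun.isSafeGuardedRun (hrun : IsRun f G h β L c₁ c₂ m w x) (hβ : 0 < β) :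
    IsSafeGuardedRun f G h L (theta₁ β L c₁) (theta₂ β L c₂) w x := by
  obtain ⟨α, hα, hstep⟩ := hrun.step
  refine ⟨hrun.init, hrun.primal, _, fun k i j hij => ?_, hstep⟩
  rw [history_comm G m k j i]
  exact halfStep_exchange hβ (hα k i j hij).1 L c₁ c₂

lemma theta₁_pos (hL : 0 < L) (hβ : β ∈ Set.Ioo 0 (1 / L)) (hc₁ : 0 < c₁) :
    0 < theta₁ β L c₁ :=
  lt_min (mul_pos hβ.1 (sub_pos.2 ((lt_div_iff₀ hL).1 hβ.2))) hc₁

lemma theta₂_pos (hL : 0 < L) (hβ : β ∈ Set.Ioo 0 (1 / L)) (hc₂ : 0 < c₂) :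
    0 < theta₂ β L c₂ :=
  lt_min (half_pos (sub_pos.2 ((lt_one_div hβ.1 hL).1 hβ.2))) hc₂

end Algorithm

section Descent

variable {n d k : ℕ} {G : SimpleGraph (Fin n)} {i j : Fin n} {a : Fin n → Fin n → ℝ}

lemma mem_nbrs : j ∈ nbrs G i ↔ G.Adj i j := by
  simp [nbrs]

lemma sum_nbrs_comm {M : Type*} [AddCommMonoid M] (G : SimpleGraph (Fin n))
    (q : Fin n → Fin n → M) : ∑ i, ∑ j ∈ nbrs G i, q i j = ∑ i, ∑ j ∈ nbrs G i, q j i := by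
  classical
  simp only [nbrs, Finset.sum_filter]
  rw [Finset.sum_comm]
  simp only [G.adj_comm]

lemma two_nsmul_sum_nbrs_smul {M : Type*} [AddCommMonoid M] [Module ℝ M]
    (ha : ∀ i j, G.Adj i j → a i j = a j i) (q : Fin n → Fin n → M) :
    2 • ∑ i, ∑ j ∈ nbrs G i, a i j • q i j =
      ∑ i, ∑ j ∈ nbrs G i, a i j • (q i j + q j i) := by
  have hswap : ∑ i, ∑ j ∈ nbrs G i, a i j • q i j = ∑ i, ∑ j ∈ nbrs G i, a i j • q j i := by
    rw [sum_nbrs_comm G fun i j => a i j • q i j]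
    exact Finset.sum_congr rfl fun i _ => Finset.sum_congr rfl fun j hj => by
      rw [ha i j (mem_nbrs.1 hj)]
  rw [two_nsmul]
  nth_rw 2 [hswap]
  simp only [smul_add, Finset.sum_add_distrib]

lemma sub_le_sum_mul_of_convexOn {E ι : Type*} [AddCommGroup E] [Module ℝ E] {φ : E → ℝ}
    (hφ : ConvexOn ℝ Set.univ φ) {s : Finset ι} {c : ι → ℝ} (hc : ∀ j ∈ s, 0 ≤ c j)
    (hsum : ∑ j ∈ s, c j ≤ 1) (p : E) (u : ι → E) :
    φ ((1 - ∑ j ∈ s, c j) • p + ∑ j ∈ s, c j • u j) - φ p ≤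
      ∑ j ∈ s, c j * (φ (u j) - φ p) := by
  have hjensen := hφ.map_add_sum_le (p := u) hc (sub_add_cancel 1 (∑ j ∈ s, c j))
    (fun _ _ => Set.mem_univ _) (sub_nonneg.2 hsum) (Set.mem_univ p)
  simp only [smul_eq_mul] at hjensen
  simp only [mul_sub, Finset.sum_sub_distrib, ← Finset.sum_mul]
  linarith

lemma two_mul_sum_sub_le_of_convexOn {E : Type*} [AddCommGroup E] [Module ℝ E]
    {φ : Fin n → E → ℝ} {v v' : Fin n → E} {u : Fin n → Fin n → E}
    (hφ : ∀ i, ConvexOn ℝ Set.univ (φ i)) (ha : ∀ i j, G.Adj i j → a i j = a j i)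
    (ha₀ : ∀ i j, G.Adj i j → 0 ≤ a i j) (hsum : ∀ i, ∑ j ∈ nbrs G i, a i j ≤ 1)
    (hv' : ∀ i, v' i = (1 - ∑ j ∈ nbrs G i, a i j) • v i + ∑ j ∈ nbrs G i, a i j • u i j) :
    2 * ∑ i, (φ i (v' i) - φ i (v i)) ≤
      ∑ i, ∑ j ∈ nbrs G i, a i j * (φ i (u i j) - φ i (v i) + (φ j (u j i) - φ j (v j))) := by
  have hhalf := two_nsmul_sum_nbrs_smul ha fun i j => φ i (u i j) - φ i (v i)
  simp only [nsmul_eq_mul, Nat.cast_ofNat, smul_eq_mul] at hhalf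
  rw [← hhalf]
  gcongr with i
  rw [hv']
  exact sub_le_sum_mul_of_convexOn (hφ i) (fun j hj => ha₀ i j (mem_nbrs.1 hj)) (hsum i) _ _

lemma two_mul_sum_norm_sub_sq_le {E : Type*} [SeminormedAddCommGroup E] [NormedSpace ℝ E]
    {v v' : Fin n → E} {u : Fin n → Fin n → E} (ha : ∀ i j, G.Adj i j → a i j = a j i)
    (ha₀ : ∀ i j, G.Adj i j → 0 ≤ a i j) (hsum : ∀ i, ∑ j ∈ nbrs G i, a i j ≤ 1)
    (hv' : ∀ i, v' i = (1 - ∑ j ∈ nbrs G i, a i j) • v i + ∑ j ∈ nbrs G i, a i j • u i j) :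
    2 * ∑ i, ‖v' i - v i‖ ^ 2 ≤
      ∑ i, ∑ j ∈ nbrs G i, a i j * (‖u i j - v i‖ ^ 2 + ‖u j i - v j‖ ^ 2) := by
  have hφ (i) : ConvexOn ℝ Set.univ fun y => ‖y - v i‖ ^ 2 := by
    simp only [← dist_eq_norm]
    exact (convexOn_dist (v i) convex_univ).pow (fun _ _ => dist_nonneg) 2
  simpa using two_mul_sum_sub_le_of_convexOn hφ ha ha₀ hsum hv'

lemma sum_eq_of_exchange {E : Type*} [AddCommGroup E] [Module ℝ E]
    {v v' : Fin n → E} {u : Fin n → Fin n → E} (ha : ∀ i j, G.Adj i j → a i j = a j i)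
    (hu : ∀ i j, G.Adj i j → u i j + u j i = v i + v j)
    (hv' : ∀ i, v' i = (1 - ∑ j ∈ nbrs G i, a i j) • v i + ∑ j ∈ nbrs G i, a i j • u i j) :
    ∑ i, v' i = ∑ i, v i := by
  have hflow : ∑ i, ∑ j ∈ nbrs G i, a i j • (u i j - v i) = 0 := by
    refine (smul_eq_zero_iff_right (two_ne_zero (α := ℝ))).1 ?_
    rw [ofNat_smul_eq_nsmul, two_nsmul_sum_nbrs_smul ha fun i j => u i j - v i]
    refine Finset.sum_eq_zero fun i _ => Finset.sum_eq_zero fun j hj => ?_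
    rw [← add_sub_add_comm, hu i j (mem_nbrs.1 hj), sub_self, smul_zero]
  rw [← sub_eq_zero, ← Finset.sum_sub_distrib, ← hflow]
  refine Finset.sum_congr rfl fun i _ => ?_
  simp only [hv', smul_sub, Finset.sum_sub_distrib, ← Finset.sum_smul, sub_smul, one_smul]
  abel

variable {f : Fin n → Vec d → EReal} {μ θ₁ θ₂ c : ℝ} {w x : ℕ → Stack n d}

lemma IsSafeGuardedRun.mem_dualSubspace {G : ℕ → SimpleGraph (Fin n)} {h : ℕ → Fin n → Fin n → ℝ}
    {L : ℝ} (hrun : IsSafeGuardedRun f G h L θ₁ θ₂ w x)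
    (hsymm : ∀ k i j, (G k).Adj i j → h k i j = h k j i) (k : ℕ) : w k ∈ dualSubspace n d := by
  obtain ⟨u, hu, hstep⟩ := hrun.step
  induction k with
  | zero => exact hrun.init
  | succ k ih => exact (sum_eq_of_exchange (hsymm k) (fun i j hij => (hu k i j hij).1)
      (hstep k)).trans ih

variable (hμ : 0 < μ) (hconv : ∀ i, StrongConvexOn (dom (f i)) μ fun x => (f i x).toReal)
  (hD : ∀ i, IsConjOn (dom (f i)) (fun x => (f i x).toReal) (dual (f i)))
include hμ hconv hD

lemma SafeGuard.dual_sub_add_dual_sub_le {u v : Vec d}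
    (hsg : SafeGuard f w (1 / μ) θ₁ θ₂ k i j u v) :
    dual (f i) u - dual (f i) (w k i) + (dual (f j) v - dual (f j) (w k j)) ≤
      min (-θ₁ * ‖dualGrad f w k i - dualGrad f w k j‖ ^ 2)
        (-θ₂ * (‖u - w k i‖ ^ 2 + ‖v - w k j‖ ^ 2)) := by
  have hu := (hD i).le_add_inner_gradient_add hμ (hconv i) (w k i) u
  have hv := (hD j).le_add_inner_gradient_add hμ (hconv j) (w k j) v
  refine le_trans ?_ hsg
  simp only [dualGrad]
  linarith

section Run

variable {G : ℕ → SimpleGraph (Fin n)} {h : ℕ → Fin n → Fin n → ℝ}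
  (hrun : IsSafeGuardedRun f G h (1 / μ) θ₁ θ₂ w x)
include hrun

lemma IsSafeGuardedRun.dualGrad_eq (hbot : ∀ i y, f i y ≠ ⊥) (k : ℕ) (i : Fin n) :
    dualGrad f w k i = x k i :=
  (hD i).gradient_eq hμ (hconv i) ((hrun.primal k i).mem_dom (hbot i) (hD i).nonempty)
    ((hD i).dual_eq (hbot i) (hrun.primal k i))

variable (hc : 0 ≤ c) (hle : ∀ k i j, (G k).Adj i j → c ≤ h k i j)
  (hsymm : ∀ k i j, (G k).Adj i j → h k i j = h k j i)
  (hsum : ∀ k i, ∑ j ∈ nbrs (G k) i, h k i j ≤ 1)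
include hc hle hsymm hsum

lemma IsSafeGuardedRun.mul_norm_sub_sq_le (hθ₂ : 0 ≤ θ₂) (k : ℕ) :
    θ₂ * ‖w (k + 1) - w k‖ ^ 2 ≤ dualObj f (w k) - dualObj f (w (k + 1)) := by
  obtain ⟨u, hu, hstep⟩ := hrun.step
  have hh₀ (i j) (hij : (G k).Adj i j) : 0 ≤ h k i j := hc.trans (hle k i j hij)
  have hmove := two_mul_sum_norm_sub_sq_le (hsymm k) hh₀ (hsum k) (hstep k)
  have hdesc := two_mul_sum_sub_le_of_convexOn (fun i => (hD i).convexOn) (hsymm k) hh₀ (hsum k)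
    (hstep k)
  have hsafe : ∑ i, ∑ j ∈ nbrs (G k) i, h k i j *
      (dual (f i) (u k i j) - dual (f i) (w k i) + (dual (f j) (u k j i) - dual (f j) (w k j))) ≤
      -θ₂ * ∑ i, ∑ j ∈ nbrs (G k) i,
        h k i j * (‖u k i j - w k i‖ ^ 2 + ‖u k j i - w k j‖ ^ 2) := by
    simp only [Finset.mul_sum]
    refine Finset.sum_le_sum fun i _ => Finset.sum_le_sum fun j hj => ?_
    have hij := mem_nbrs.1 hj
    rw [mul_left_comm]
    exact mul_le_mul_of_nonneg_left
      ((SafeGuard.dual_sub_add_dual_sub_le hμ hconv hD (hu k i j hij).2).trans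
        (min_le_right _ _)) (hh₀ i j hij)
  rw [Finset.sum_sub_distrib] at hdesc
  rw [PiLp.norm_sq_eq_of_L2]
  have := mul_le_mul_of_nonneg_left hmove hθ₂
  simp only [dualObj, PiLp.sub_apply]
  linarith

lemma IsSafeGuardedRun.mul_dirichletEnergy_le (hθ₁ : 0 ≤ θ₁) (k : ℕ) :
    c * θ₁ * dirichletEnergy (G k) (dualGrad f w k) ≤
      dualObj f (w k) - dualObj f (w (k + 1)) := by
  obtain ⟨u, hu, hstep⟩ := hrun.step
  have hh₀ (i j) (hij : (G k).Adj i j) : 0 ≤ h k i j := hc.trans (hle k i j hij)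
  have hdesc := two_mul_sum_sub_le_of_convexOn (fun i => (hD i).convexOn) (hsymm k) hh₀ (hsum k)
    (hstep k)
  have hsafe : ∑ i, ∑ j ∈ nbrs (G k) i, h k i j *
      (dual (f i) (u k i j) - dual (f i) (w k i) + (dual (f j) (u k j i) - dual (f j) (w k j))) ≤
      -(c * θ₁) * ∑ i, ∑ j ∈ nbrs (G k) i, ‖dualGrad f w k i - dualGrad f w k j‖ ^ 2 := by
    simp only [Finset.mul_sum]
    refine Finset.sum_le_sum fun i _ => Finset.sum_le_sum fun j hj => ?_
    have hij := mem_nbrs.1 hj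
    have hdrop := (SafeGuard.dual_sub_add_dual_sub_le hμ hconv hD (hu k i j hij).2).trans
      (min_le_left _ _)
    calc _ ≤ h k i j * (-θ₁ * ‖dualGrad f w k i - dualGrad f w k j‖ ^ 2) := by
          gcongr; exact hh₀ i j hij
      _ ≤ _ := by
          have := mul_le_mul_of_nonneg_right (hle k i j hij)
            (mul_nonneg hθ₁ (sq_nonneg ‖dualGrad f w k i - dualGrad f w k j‖))
          linarith
  rw [Finset.sum_sub_distrib] at hdesc
  simp only [dualObj, dirichletEnergy]
  linarith

end Run

end Descent

section Window

variable {n : ℕ} {G : ℕ → SimpleGraph (Fin n)} {B K : ℕ} {i j : Fin n}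

lemma unionGraph_adj : (unionGraph G B K).Adj i j ↔ ∃ s < B, (G (K + s)).Adj i j := by
  simp only [unionGraph, SimpleGraph.iSup_adj, Set.mem_Ico]
  constructor
  · rintro ⟨t, ⟨hKt, htB⟩, hadj⟩
    exact ⟨t - K, by omega, by rwa [Nat.add_sub_cancel' hKt]⟩
  · rintro ⟨s, hs, hadj⟩
    exact ⟨K + s, ⟨by omega, by omega⟩, hadj⟩

lemma card_nbrs_le_degMax (G : ℕ → SimpleGraph (Fin n)) (B t : ℕ) (i : Fin n) :
    (nbrs (unionGraph G B (t * B)) i).card ≤ degMax G B := by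
  classical
  have hbdd : BddAbove (Set.range fun t : ℕ => (unionGraph G B (t * B)).maxDegree) :=
    ((Set.finite_range fun H : SimpleGraph (Fin n) => H.maxDegree).subset
      (Set.range_comp_subset_range (fun t => unionGraph G B (t * B)) _)).bddAbove
  have hcard : (nbrs (unionGraph G B (t * B)) i).card = (unionGraph G B (t * B)).degree i := by
    rw [← SimpleGraph.card_neighborFinset_eq_degree]
    congr 1
    ext j
    simp [mem_nbrs]
  rw [hcard, degMax]
  refine ((unionGraph G B (t * B)).degree_le_maxDegree i).trans ?_
  convert le_ciSup hbdd t

lemma sum_nbrs_add_le {H : SimpleGraph (Fin n)} {η : ℕ} (hdeg : ∀ i, (nbrs H i).card ≤ η)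
    {z : Fin n → ℝ} (hz : ∀ i, 0 ≤ z i) :
    ∑ i, ∑ j ∈ nbrs H i, (z i + z j) ≤ 2 * (η * ∑ i, z i) := by
  have hswap := sum_nbrs_comm H fun i _ => z i
  have hle : ∑ i, ∑ _j ∈ nbrs H i, z i ≤ η * ∑ i, z i := by
    rw [Finset.mul_sum]
    refine Finset.sum_le_sum fun i _ => ?_
    rw [Finset.sum_const, nsmul_eq_mul]
    exact mul_le_mul_of_nonneg_right (Nat.cast_le.2 (hdeg i)) (hz i)
  simp only [Finset.sum_add_distrib]
  linarith

variable {E : Type*} [SeminormedAddCommGroup E]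

lemma norm_sub_sq_le_three_mul (a b a' b' : E) :
    ‖a - b‖ ^ 2 ≤ 3 * (‖a' - a‖ ^ 2 + ‖a' - b'‖ ^ 2 + ‖b' - b‖ ^ 2) := by
  have htri : ‖a - b‖ ≤ ‖a' - a‖ + ‖a' - b'‖ + ‖b' - b‖ := by
    rw [← norm_sub_rev a, ← sub_add_sub_cancel a b' b, ← sub_add_sub_cancel a a' b']
    exact norm_add₃_le
  refine (pow_le_pow_left₀ (norm_nonneg _) htri 2).trans ?_
  nlinarith [sq_nonneg (‖a' - a‖ - ‖a' - b'‖), sq_nonneg (‖a' - b'‖ - ‖b' - b‖),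
    sq_nonneg (‖a' - a‖ - ‖b' - b‖)]

lemma norm_sub_sq_le_mul_sum (v : ℕ → E) (K : ℕ) {s : ℕ} (hs : s ≤ B) :
    ‖v (K + s) - v K‖ ^ 2 ≤ B * ∑ r ∈ Finset.range B, ‖v (K + r + 1) - v (K + r)‖ ^ 2 := by
  have htel : v (K + s) - v K = ∑ r ∈ Finset.range s, (v (K + r + 1) - v (K + r)) :=
    (Finset.sum_range_sub (fun r => v (K + r)) s).symm
  calc ‖v (K + s) - v K‖ ^ 2 ≤ (∑ r ∈ Finset.range s, ‖v (K + r + 1) - v (K + r)‖) ^ 2 := by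
        rw [htel]
        gcongr
        exact norm_sum_le _ _
    _ ≤ s * ∑ r ∈ Finset.range s, ‖v (K + r + 1) - v (K + r)‖ ^ 2 := by
        simpa using sq_sum_le_card_mul_sum_sq (s := Finset.range s)
          (f := fun r => ‖v (K + r + 1) - v (K + r)‖)
    _ ≤ _ := by gcongr

open Classical in
lemma sum_sum_ite_adj_eq (G : ℕ → SimpleGraph (Fin n)) (y : ℕ → Fin n → E) (B K : ℕ) :
    ∑ i, ∑ j, ∑ s ∈ Finset.range B,
        (if (G (K + s)).Adj i j then ‖y (K + s) i - y (K + s) j‖ ^ 2 else 0) =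
      2 * ∑ s ∈ Finset.range B, dirichletEnergy (G (K + s)) (y (K + s)) := by
  rw [Finset.sum_congr rfl fun i _ => Finset.sum_comm, Finset.sum_comm, Finset.mul_sum]
  simp only [dirichletEnergy, nbrs, Finset.sum_filter]
  exact Finset.sum_congr rfl fun s _ => (mul_div_cancel₀ _ two_ne_zero).symm

-- An edge of the union graph is an edge of some `G (K + s)`; comparing `y K` with `y (K + s)` at
-- both of its ends costs two drifts, whence the factor `3`.
lemma dirichletEnergy_unionGraph_le {η : ℕ} (hdeg : ∀ i, (nbrs (unionGraph G B K) i).card ≤ η)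
    (y : ℕ → Fin n → E) :
    dirichletEnergy (unionGraph G B K) (y K) ≤
      3 * B * η * ∑ s ∈ Finset.range B, ∑ i, ‖y (K + s + 1) i - y (K + s) i‖ ^ 2 +
        3 * ∑ s ∈ Finset.range B, dirichletEnergy (G (K + s)) (y (K + s)) := by
  classical
  set Z : Fin n → ℝ := fun i => ∑ s ∈ Finset.range B, ‖y (K + s + 1) i - y (K + s) i‖ ^ 2
  set Y : Fin n → Fin n → ℝ := fun i j => ∑ s ∈ Finset.range B,
    if (G (K + s)).Adj i j then ‖y (K + s) i - y (K + s) j‖ ^ 2 else 0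
  have hY₀ (i j) : 0 ≤ Y i j := Finset.sum_nonneg fun s _ => by positivity
  have hedge : ∀ i, ∀ j ∈ nbrs (unionGraph G B K) i,
      ‖y K i - y K j‖ ^ 2 ≤ 3 * (B * (Z i + Z j) + Y i j) := by
    intro i j hj
    obtain ⟨s, hs, hadj⟩ := unionGraph_adj.1 (mem_nbrs.1 hj)
    have hYs : ‖y (K + s) i - y (K + s) j‖ ^ 2 ≤ Y i j := by
      simpa only [hadj, if_true] using Finset.single_le_sum (f := fun s =>
        if (G (K + s)).Adj i j then ‖y (K + s) i - y (K + s) j‖ ^ 2 else 0)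
        (fun s _ => by positivity) (Finset.mem_range.2 hs)
    have hdrift (l) := norm_sub_sq_le_mul_sum (fun k => y k l) K hs.le
    linarith [norm_sub_sq_le_three_mul (y K i) (y K j) (y (K + s) i) (y (K + s) j),
      hdrift i, hdrift j]
  have hYsum : ∑ i, ∑ j ∈ nbrs (unionGraph G B K) i, Y i j ≤
      2 * ∑ s ∈ Finset.range B, dirichletEnergy (G (K + s)) (y (K + s)) := by
    rw [← sum_sum_ite_adj_eq]
    exact Finset.sum_le_sum fun i _ =>
      Finset.sum_le_sum_of_subset_of_nonneg (Finset.subset_univ _) fun j _ _ => hY₀ i j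
  have hZsum := sum_nbrs_add_le hdeg (z := Z) fun i => Finset.sum_nonneg fun s _ => sq_nonneg _
  have htotal := Finset.sum_le_sum fun i (_ : i ∈ Finset.univ) => Finset.sum_le_sum (hedge i)
  have hsplit : ∑ i, ∑ j ∈ nbrs (unionGraph G B K) i, 3 * (B * (Z i + Z j) + Y i j) =
      3 * (B * ∑ i, ∑ j ∈ nbrs (unionGraph G B K) i, (Z i + Z j) +
        ∑ i, ∑ j ∈ nbrs (unionGraph G B K) i, Y i j) := by
    simp only [Finset.mul_sum, ← Finset.sum_add_distrib, mul_add]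
  rw [dirichletEnergy, Finset.sum_comm, div_le_iff₀ two_pos]
  have := mul_le_mul_of_nonneg_left hZsum (Nat.cast_nonneg (α := ℝ) B)
  linarith

end Window

section Rate

open Filter

variable {a : ℕ → ℝ} {l T : ℝ}

lemma le_div_of_mul_sq_le_mul_sub (ha : ∀ t, 0 ≤ a t) (hl : 0 < l) (hT : 0 ≤ T)
    (hrec : ∀ t, l * a t ^ 2 ≤ T * (a t - a (t + 1))) (t : ℕ) :
    a t ≤ T * a 0 / (T + l * t * a 0) := by
  rcases hT.eq_or_lt with rfl | hT
  · have hzero : l * a t ^ 2 ≤ 0 := by simpa using hrec t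
    have hat : a t ^ 2 ≤ 0 := nonpos_of_mul_nonpos_right hzero hl
    simp [sq_nonpos_iff _ |>.1 hat]
  have hden (t : ℕ) : 0 < T + l * t * a 0 :=
    add_pos_of_pos_of_nonneg hT (mul_nonneg (mul_nonneg hl.le t.cast_nonneg) (ha 0))
  have hanti (t) : a (t + 1) ≤ a t :=
    sub_nonneg.1 (nonneg_of_mul_nonneg_right
      ((mul_nonneg hl.le (sq_nonneg _)).trans (hrec t)) hT)
  rw [le_div_iff₀ (hden t)]
  induction t with
  | zero => simp [mul_comm]
  | succ t ih =>
    rcases (ha t).eq_or_lt with h0 | h0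
    · rw [le_antisymm (h0 ▸ hanti t) (ha _), zero_mul]
      exact mul_nonneg hT.le (ha 0)
    · have hstep : a (t + 1) * (T + l * a t) ≤ T * a t := by
        have := mul_le_mul_of_nonneg_left (hanti t) (mul_nonneg hl.le h0.le)
        linarith [hrec t]
      refine le_of_mul_le_mul_left ?_ h0
      have hprev := mul_le_mul_of_nonneg_left ih (ha (t + 1))
      have hnext := mul_le_mul_of_nonneg_left hstep (ha 0)
      push_cast
      linarith

lemma isBigO_one_div_of_le_div {B : ℕ} (hB : 0 < B) (ha : ∀ k, 0 ≤ a k) (hl : 0 < l)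
    (hT : 0 ≤ T) (hle : ∀ k, a k ≤ T * a 0 / (T + l * ((k / B : ℕ) : ℝ) * a 0)) :
    a =O[atTop] fun k : ℕ => 1 / (k : ℝ) := by
  refine Asymptotics.IsBigO.of_bound (2 * B * T / l) ?_
  filter_upwards [eventually_ge_atTop B] with k hk
  have hq : (0 : ℝ) < (k / B : ℕ) := Nat.cast_pos.2 (Nat.div_pos hk hB)
  have hk₀ : (0 : ℝ) < k := Nat.cast_pos.2 (hB.trans_le hk)
  have hkq : (k : ℝ) ≤ 2 * B * (k / B : ℕ) := by
    have hfloor : k < B * (k / B + 1) := Nat.lt_mul_div_succ k hB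
    have hone : B * 1 ≤ B * (k / B) := Nat.mul_le_mul_left B (Nat.div_pos hk hB)
    exact_mod_cast (by linarith : k ≤ 2 * B * (k / B))
  have hlq : 0 < l * (k / B : ℕ) := mul_pos hl hq
  rw [Real.norm_of_nonneg (ha k), Real.norm_of_nonneg (by positivity)]
  calc a k ≤ T / (l * (k / B : ℕ)) := by
        refine (hle k).trans (div_le_of_le_mul₀ ?_ (by positivity) ?_)
        · exact add_nonneg hT (mul_nonneg hlq.le (ha 0))
        · rw [div_mul_eq_mul_div, le_div_iff₀ hlq]
          nlinarith [mul_nonneg hT hT, mul_nonneg hT hlq.le]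
    _ ≤ T * (2 * B) / (l * k) := by
        rw [div_le_div_iff₀ hlq (mul_pos hl hk₀)]
        have := mul_le_mul_of_nonneg_left hkq (mul_nonneg hT hl.le)
        linarith
    _ = 2 * B * T / l * (1 / k) := by field_simp

lemma isBigO_one_div_sqrt_of_le_mul_sqrt {E : Type*} [SeminormedAddCommGroup E] {b : ℕ → E}
    {c₁ c₂ : ℝ} (ha : a =O[atTop] fun k : ℕ => 1 / (k : ℝ))
    (hb : ∀ k, ‖b k‖ ≤ c₁ * √(c₂ * a k)) :
    b =O[atTop] fun k : ℕ => 1 / √(k : ℝ) := by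
  have hsqrt := (ha.const_mul_left c₂).sqrt (Eventually.of_forall fun k => by positivity)
  refine (Asymptotics.IsBigO.of_norm_le hb).trans (hsqrt.const_mul_left c₁) |>.congr_right ?_
  exact fun k => by rw [Real.sqrt_div zero_le_one, Real.sqrt_one]

end Rate

section Weights

variable {n : ℕ} {G : ℕ → SimpleGraph (Fin n)} {h : ℕ → Fin n → Fin n → ℝ} {B K k : ℕ}
  {i j : Fin n} {c : ℝ}

lemma exists_adj_of_connected_unionGraph (hG : (unionGraph G B K).Connected) (hn : 2 ≤ n) :
    ∃ k i j, (G k).Adj i j := by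
  have : Nontrivial (Fin n) := Fin.nontrivial_iff_two_le.2 hn
  obtain ⟨i⟩ := hG.nonempty
  obtain ⟨j, hij⟩ := hG.preconnected.exists_adj_of_nontrivial i
  obtain ⟨s, -, hs⟩ := unionGraph_adj.1 hij
  exact ⟨K + s, i, j, hs⟩

lemma weightInf_le (hc : ∀ k i j, (G k).Adj i j → c ≤ h k i j) (hij : (G k).Adj i j) :
    weightInf G h ≤ h k i j :=
  csInf_le ⟨c, by rintro _ ⟨k, i, j, hij, rfl⟩; exact hc k i j hij⟩ ⟨k, i, j, hij, rfl⟩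

lemma weightInf_nonneg (hpos : ∃ c > 0, ∀ k i j, (G k).Adj i j → c ≤ h k i j) :
    0 ≤ weightInf G h := by
  obtain ⟨c, hc₀, hc⟩ := hpos
  exact Real.sInf_nonneg (by rintro _ ⟨k, i, j, hij, rfl⟩; exact hc₀.le.trans (hc k i j hij))

lemma weightInf_pos (hpos : ∃ c > 0, ∀ k i j, (G k).Adj i j → c ≤ h k i j)
    (hne : ∃ k i j, (G k).Adj i j) : 0 < weightInf G h := by
  obtain ⟨c, hc₀, hc⟩ := hpos
  obtain ⟨k, i, j, hij⟩ := hne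
  refine hc₀.trans_le (le_csInf ⟨_, k, i, j, hij, rfl⟩ ?_)
  rintro _ ⟨k, i, j, hij, rfl⟩
  exact hc k i j hij

end Weights

section RunRate

open Filter

variable {n d B : ℕ} {f : Fin n → Vec d → EReal} {G : ℕ → SimpleGraph (Fin n)}
  {h : ℕ → Fin n → Fin n → ℝ} {μ θ₁ θ₂ R : ℝ} {w x : ℕ → Stack n d} {v ws : Stack n d}

/-- The constant `3 B L² η̃ / θ₂ + 3 / (h̲ θ₁)` of the dual rate, as a function of the safe-guard
constants; it is `tau` at `theta₁` and `theta₂`. -/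
def rateConst (G : ℕ → SimpleGraph (Fin n)) (h : ℕ → Fin n → Fin n → ℝ) (B : ℕ)
    (L θ₁ θ₂ : ℝ) : ℝ :=
  3 * B * L ^ 2 * degMax G B / θ₂ + 3 / (weightInf G h * θ₁)

lemma rateConst_nonneg {L : ℝ} (hpos : ∃ c > 0, ∀ k i j, (G k).Adj i j → c ≤ h k i j)
    (hθ₁ : 0 < θ₁) (hθ₂ : 0 < θ₂) : 0 ≤ rateConst G h B L θ₁ θ₂ := by
  have := weightInf_nonneg hpos
  rw [rateConst]
  positivity

lemma dirichletEnergy_unionGraph_le_mul_sub {η K : ℕ} {L ρ θ : ℝ} {y : ℕ → Stack n d}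
    {D : ℕ → ℝ} (hρ : 0 < ρ) (hθ : 0 < θ)
    (hdeg : ∀ i, (nbrs (unionGraph G B K) i).card ≤ η)
    (henergy : ∀ k, ρ * dirichletEnergy (G k) (y k) ≤ D k - D (k + 1))
    (hstep : ∀ k, θ * ‖y (k + 1) - y k‖ ^ 2 ≤ L ^ 2 * (D k - D (k + 1))) :
    dirichletEnergy (unionGraph G B K) (y K) ≤
      (3 * B * L ^ 2 * η / θ + 3 / ρ) * (D K - D (K + B)) := by
  have htel : ∑ s ∈ Finset.range B, (D (K + s) - D (K + s + 1)) = D K - D (K + B) :=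
    Finset.sum_range_sub' (fun s => D (K + s)) B
  have henergy' (k) : dirichletEnergy (G k) (y k) ≤ 1 / ρ * (D k - D (k + 1)) := by
    rw [one_div_mul_eq_div, le_div_iff₀' hρ]
    exact henergy k
  have hstep' (k) : ∑ i, ‖y (k + 1) i - y k i‖ ^ 2 ≤ L ^ 2 / θ * (D k - D (k + 1)) := by
    rw [div_mul_eq_mul_div, le_div_iff₀' hθ]
    simpa only [PiLp.norm_sq_eq_of_L2, PiLp.sub_apply] using hstep k
  calc dirichletEnergy (unionGraph G B K) (y K)
      ≤ 3 * B * η * ∑ s ∈ Finset.range B, ∑ i, ‖y (K + s + 1) i - y (K + s) i‖ ^ 2 +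
          3 * ∑ s ∈ Finset.range B, dirichletEnergy (G (K + s)) (y (K + s)) :=
        dirichletEnergy_unionGraph_le hdeg fun k => y k
    _ ≤ 3 * B * η * ∑ s ∈ Finset.range B, L ^ 2 / θ * (D (K + s) - D (K + s + 1)) +
          3 * ∑ s ∈ Finset.range B, 1 / ρ * (D (K + s) - D (K + s + 1)) := by
        gcongr with s _ s _
        · exact hstep' (K + s)
        · exact henergy' (K + s)
    _ = (3 * B * L ^ 2 * η / θ + 3 / ρ) * (D K - D (K + B)) := by
        rw [← Finset.mul_sum, ← Finset.mul_sum, htel]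
        ring

lemma eq_zero_of_mem_dualSubspace (hn : n < 2) (hv : v ∈ dualSubspace n d) : v = 0 := by
  have : Subsingleton (Fin n) := Fin.subsingleton_iff_le_one.2 (Nat.lt_succ_iff.1 hn)
  have hv' : ∑ i, v i = 0 := hv
  ext1 i
  rwa [Fintype.sum_subsingleton _ i] at hv'

variable (hμ : 0 < μ) (hconv : ∀ i, StrongConvexOn (dom (f i)) μ fun x => (f i x).toReal)
  (hD : ∀ i, IsConjOn (dom (f i)) (fun x => (f i x).toReal) (dual (f i)))
include hμ hconv hD

lemma lapMin_mul_dualObj_sub_sq_le {H : SimpleGraph (Fin n)} (hH : H.Connected) (hn : 2 ≤ n)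
    (hv : v ∈ dualSubspace n d) (hws : ws ∈ dualSubspace n d) (hle : dualObj f ws ≤ dualObj f v)
    (hR : ‖v - ws‖ ≤ R) :
    lapMin H * (dualObj f v - dualObj f ws) ^ 2 ≤
      R ^ 2 * dirichletEnergy H ⇑(gradient (dualObj f) v) := by
  have hgap : dualObj f v - dualObj f ws ≤
      ‖(dualSubspace n d).starProjection (gradient (dualObj f) v)‖ * R :=
    ((isConjOn_dualObj hD).sub_le_norm_starProjection_mul hμ (strongConvexOn_realObj hconv)
      hv hws).trans (by gcongr)
  calc lapMin H * (dualObj f v - dualObj f ws) ^ 2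
      ≤ lapMin H * (‖(dualSubspace n d).starProjection (gradient (dualObj f) v)‖ * R) ^ 2 := by
        have := (lapMin_pos hH hn).le
        have := sub_nonneg.2 hle
        gcongr
    _ = R ^ 2 *
          (lapMin H * ‖(dualSubspace n d).starProjection (gradient (dualObj f) v)‖ ^ 2) := by
        ring
    _ ≤ R ^ 2 * dirichletEnergy H ⇑(gradient (dualObj f) v) := by
        gcongr
        exact lapMin_mul_norm_starProjection_sq_le hH _

variable (hrun : IsSafeGuardedRun f G h (1 / μ) θ₁ θ₂ w x)
include hrun

lemma IsSafeGuardedRun.gradient_dualObj_eq (hbot : ∀ i y, f i y ≠ ⊥) (k : ℕ) :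
    gradient (dualObj f) (w k) = x k :=
  (isConjOn_dualObj hD).gradient_eq hμ (strongConvexOn_realObj hconv)
    (mem_domain_of_isConjMaximizer hbot hD (hrun.primal k))
    (dualObj_eq_inner_sub hbot hD (hrun.primal k))

variable (hpos : ∃ c > 0, ∀ k i j, (G k).Adj i j → c ≤ h k i j)
  (hsymm : ∀ k i j, (G k).Adj i j → h k i j = h k j i)
  (hsum : ∀ k i, ∑ j ∈ nbrs (G k) i, h k i j ≤ 1) (hθ₂ : 0 < θ₂)
include hpos hsymm hsum hθ₂

lemma IsSafeGuardedRun.antitone_dualObj : Antitone fun k => dualObj f (w k) := by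
  obtain ⟨c, hc, hle⟩ := hpos
  exact antitone_nat_of_succ_le fun k => sub_nonneg.1 ((mul_nonneg hθ₂.le (sq_nonneg _)).trans
    (hrun.mul_norm_sub_sq_le hμ hconv hD hc.le hle hsymm hsum hθ₂.le k))

variable (hθ₁ : 0 < θ₁) (hbot : ∀ i y, f i y ≠ ⊥)
include hθ₁ hbot

lemma IsSafeGuardedRun.dirichletEnergy_unionGraph_le (hadj : ∃ k i j, (G k).Adj i j)
    (t : ℕ) :
    dirichletEnergy (unionGraph G B (t * B)) (x (t * B)) ≤
      rateConst G h B (1 / μ) θ₁ θ₂ *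
        (dualObj f (w (t * B)) - dualObj f (w ((t + 1) * B))) := by
  have hw := weightInf_pos hpos hadj
  obtain ⟨c, -, hc⟩ := hpos
  have hle (k i j) (hij : (G k).Adj i j) : weightInf G h ≤ h k i j := weightInf_le hc hij
  rw [Nat.succ_mul]
  refine dirichletEnergy_unionGraph_le_mul_sub (y := x) (D := fun k => dualObj f (w k))
    (mul_pos hw hθ₁) hθ₂ (card_nbrs_le_degMax G B t) (fun k => ?_) (fun k => ?_)
  · have hdual : dualGrad f w k = x k :=
      funext fun i => hrun.dualGrad_eq hμ hconv hD hbot k i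
    rw [← hdual]
    exact hrun.mul_dirichletEnergy_le hμ hconv hD hw.le hle hsymm hsum hθ₁.le k
  · have hlip := (isConjOn_dualObj hD).norm_gradient_sub_le hμ (strongConvexOn_realObj hconv)
      (w (k + 1)) (w k)
    rw [hrun.gradient_dualObj_eq hμ hconv hD hbot,
      hrun.gradient_dualObj_eq hμ hconv hD hbot] at hlip
    calc θ₂ * ‖x (k + 1) - x k‖ ^ 2 ≤ θ₂ * (1 / μ * ‖w (k + 1) - w k‖) ^ 2 := by gcongr
      _ = (1 / μ) ^ 2 * (θ₂ * ‖w (k + 1) - w k‖ ^ 2) := by ring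
      _ ≤ _ := by
        gcongr
        exact hrun.mul_norm_sub_sq_le hμ hconv hD hw.le hle hsymm hsum hθ₂.le k

variable (hconn : ∀ t, (unionGraph G B (t * B)).Connected)
  (hws : ws ∈ dualSubspace n d) (hmin : IsMinOn (dualObj f) (dualSubspace n d) ws)
  (hR : ∀ k, ‖w k - ws‖ ≤ R)
include hconn hws hmin hR

lemma IsSafeGuardedRun.lapInf_mul_sq_le (hn : 2 ≤ n) (t : ℕ) :
    lapInf G B * (dualObj f (w (t * B)) - dualObj f ws) ^ 2 ≤
      rateConst G h B (1 / μ) θ₁ θ₂ * R ^ 2 *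
        (dualObj f (w (t * B)) - dualObj f (w ((t + 1) * B))) := by
  have hmem := hrun.mem_dualSubspace hsymm (t * B)
  have henergy := lapMin_mul_dualObj_sub_sq_le hμ hconv hD (hconn t) hn hmem hws (hmin hmem)
    (hR (t * B))
  rw [hrun.gradient_dualObj_eq hμ hconv hD hbot] at henergy
  calc lapInf G B * (dualObj f (w (t * B)) - dualObj f ws) ^ 2
      ≤ lapMin (unionGraph G B (t * B)) * (dualObj f (w (t * B)) - dualObj f ws) ^ 2 := by
        gcongr
        exact lapInf_le_lapMin G B t
    _ ≤ R ^ 2 * dirichletEnergy (unionGraph G B (t * B)) (x (t * B)) := henergy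
    _ ≤ R ^ 2 * (rateConst G h B (1 / μ) θ₁ θ₂ *
          (dualObj f (w (t * B)) - dualObj f (w ((t + 1) * B)))) := by
        gcongr
        exact hrun.dirichletEnergy_unionGraph_le hμ hconv hD hpos hsymm hsum hθ₂ hθ₁ hbot
          (exists_adj_of_connected_unionGraph (hconn t) hn) t
    _ = _ := by ring

theorem IsSafeGuardedRun.dualObj_sub_le (k : ℕ) :
    dualObj f (w k) - dualObj f ws ≤
      rateConst G h B (1 / μ) θ₁ θ₂ * R ^ 2 * (dualObj f (w 0) - dualObj f ws) /
        (rateConst G h B (1 / μ) θ₁ θ₂ * R ^ 2 +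
          lapInf G B * ((k / B : ℕ) : ℝ) * (dualObj f (w 0) - dualObj f ws)) := by
  rcases lt_or_ge n 2 with hn | hn
  · have hzero (k) : w k = 0 := eq_zero_of_mem_dualSubspace hn (hrun.mem_dualSubspace hsymm k)
    simp [hzero, eq_zero_of_mem_dualSubspace hn hws]
  · have hanti := hrun.antitone_dualObj hμ hconv hD hpos hsymm hsum hθ₂
    have hrate := le_div_of_mul_sq_le_mul_sub (a := fun t => dualObj f (w (t * B)) - dualObj f ws)
      (fun t => sub_nonneg.2 (hmin (hrun.mem_dualSubspace hsymm _))) (lapInf_pos hconn hn)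
      (mul_nonneg (rateConst_nonneg hpos hθ₁ hθ₂) (sq_nonneg R)) (fun t => by
        rw [sub_sub_sub_cancel_right]
        exact hrun.lapInf_mul_sq_le hμ hconv hD hpos hsymm hsum hθ₂ hθ₁ hbot hconn hws hmin
          hR hn t) (k / B)
    rw [zero_mul] at hrate
    exact (sub_le_sub_right (hanti (Nat.div_mul_le_self k B)) _).trans hrate

theorem IsSafeGuardedRun.isBigO_dualObj_sub (hB : 0 < B) :
    (fun k => dualObj f (w k) - dualObj f ws) =O[atTop] fun k : ℕ => 1 / (k : ℝ) := by
  rcases lt_or_ge n 2 with hn | hn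
  · have hzero (k) : w k = 0 := eq_zero_of_mem_dualSubspace hn (hrun.mem_dualSubspace hsymm k)
    simpa [hzero, eq_zero_of_mem_dualSubspace hn hws] using Asymptotics.isBigO_zero _ _
  · exact isBigO_one_div_of_le_div hB
      (fun k => sub_nonneg.2 (hmin (hrun.mem_dualSubspace hsymm k))) (lapInf_pos hconn hn)
      (mul_nonneg (rateConst_nonneg hpos hθ₁ hθ₂) (sq_nonneg R))
      (hrun.dualObj_sub_le hμ hconv hD hpos hsymm hsum hθ₂ hθ₁ hbot hconn hws hmin hR)

end RunRate

section Optimum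

variable {n d : ℕ} {f : Fin n → Vec d → EReal} {μ r : ℝ} {v w₀ ws x xs : Stack n d}

lemma isLeast_dualValue (hws : ws ∈ dualSubspace n d)
    (hmin : IsMinOn (dualObj f) (dualSubspace n d) ws) :
    dualValue f = dualObj f ws ∧ IsLeast (dualObj f '' dualFeasible n d) (dualValue f) := by
  have hleast : IsLeast (dualObj f '' dualFeasible n d) (dualObj f ws) :=
    ⟨⟨ws, hws, rfl⟩, by rintro _ ⟨v, hv, rfl⟩; exact hmin hv⟩
  have hvalue : dualValue f = dualObj f ws := hleast.csInf_eq
  exact ⟨hvalue, hvalue ▸ hleast⟩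

lemma norm_sub_le_radius (hS : IsCompact (sublevel f w₀)) (hv : v ∈ sublevel f w₀)
    (hws : ws ∈ sublevel f w₀) : ‖v - ws‖ ≤ radius f w₀ :=
  dist_eq_norm v ws ▸ Metric.dist_le_diam_of_mem hS.isBounded hv hws

lemma norm_le_radius_add (hS : IsCompact (sublevel f w₀)) (hw₀ : w₀ ∈ dualSubspace n d)
    (hv : v ∈ sublevel f w₀) : ‖v‖ ≤ radius f w₀ + ‖w₀‖ := by
  have hdist := norm_sub_le_radius hS hv ⟨le_rfl, hw₀⟩
  linarith [norm_le_norm_add_norm_sub' v w₀]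

variable (hμ : 0 < μ) (hconv : ∀ i, StrongConvexOn (dom (f i)) μ fun x => (f i x).toReal)
  (hD : ∀ i, IsConjOn (dom (f i)) (fun x => (f i x).toReal) (dual (f i)))
include hμ hconv hD

lemma isCompact_sublevel (hint : (interior (⋂ i, dom (f i))).Nonempty) (w₀ : Stack n d) :
    IsCompact (sublevel f w₀) := by
  obtain ⟨z, hz, M, hnear⟩ := exists_eventually_mem_domain_and_le
    ((strongConvexOn_realObj hconv).strictConvexOn hμ).convexOn hint
  rw [← coe_dualSubspace_orthogonal] at hz
  exact (isConjOn_dualObj hD).isCompact_sublevel hnear hz (dualObj f w₀)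

lemma exists_isMinOn_dualObj (hint : (interior (⋂ i, dom (f i))).Nonempty) :
    ∃ ws ∈ dualSubspace n d, IsMinOn (dualObj f) (dualSubspace n d) ws ∧
      IsGLB (realObj f '' (domain f ∩ consensus n d)) (-dualObj f ws) := by
  obtain ⟨z, hz, M, hnear⟩ := exists_eventually_mem_domain_and_le
    ((strongConvexOn_realObj hconv).strictConvexOn hμ).convexOn hint
  rw [← coe_dualSubspace_orthogonal] at hz ⊢
  obtain ⟨ws, hws, hmin⟩ := (isConjOn_dualObj hD).exists_isMinOn hnear hz
  exact ⟨ws, hws, hmin, (isConjOn_dualObj hD).isGLB_image_inter_orthogonal hμ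
    (strongConvexOn_realObj hconv) hws hmin hnear hz⟩

variable (hbot : ∀ i y, f i y ≠ ⊥) (hws : ws ∈ dualSubspace n d)
  (hF : IsGLB (realObj f '' (domain f ∩ consensus n d)) (-dualObj f ws))
include hbot hws hF

lemma IsPrimalSolution.gradient_dualObj_eq (hxs : IsPrimalSolution f xs) :
    gradient (dualObj f) ws = xs := by
  obtain ⟨hdom, hcons, hle⟩ := (isPrimalSolution_iff hbot hF).1 hxs
  rw [← coe_dualSubspace_orthogonal] at hcons
  exact (isConjOn_dualObj hD).gradient_eq_of_le_neg hμ (strongConvexOn_realObj hconv) hws hdom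
    hcons hle

variable (hmin : IsMinOn (dualObj f) (dualSubspace n d) ws)
include hmin

lemma IsPrimalSolution.norm_sub_le_sqrt (hxs : IsPrimalSolution f xs)
    (hv : v ∈ dualSubspace n d) (hx : ∀ i, IsConjMaximizer (f i) (v i) (x i)) :
    ‖x - xs‖ ≤ √(2 * (1 / μ) * (dualObj f v - dualObj f ws)) := by
  rw [← hxs.gradient_dualObj_eq hμ hconv hD hbot hws hF,
    ← (isConjOn_dualObj hD).gradient_eq hμ (strongConvexOn_realObj hconv)
      (mem_domain_of_isConjMaximizer hbot hD hx) (dualObj_eq_inner_sub hbot hD hx)]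
  exact (isConjOn_dualObj hD).norm_gradient_sub_le_sqrt hμ (strongConvexOn_realObj hconv) hws
    hmin hv

lemma abs_toReal_primalObj_sub_le (hv : v ∈ dualSubspace n d)
    (hx : ∀ i, IsConjMaximizer (f i) (v i) (x i)) (hvr : ‖v‖ ≤ r) (hwr : ‖ws‖ ≤ r) :
    |(primalObj f x).toReal - (primalValue f).toReal| ≤
      r * √(2 * (1 / μ) * (dualObj f v - dualObj f ws)) := by
  have hdom := mem_domain_of_isConjMaximizer hbot hD hx
  rw [primalObj_eq_coe_realObj hbot hdom, primalValue_eq_coe_of_isGLB hbot hF, EReal.toReal_coe,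
    EReal.toReal_coe, sub_neg_eq_add]
  exact (isConjOn_dualObj hD).abs_add_le_mul_sqrt hμ (strongConvexOn_realObj hconv) hws hmin hv
    hdom (dualObj_eq_inner_sub hbot hD hx) hvr hwr

lemma existsUnique_isPrimalSolution
    (hmax : ∀ i, ∃ y, IsConjMaximizer (f i) (ws i) y) : ∃! xs, IsPrimalSolution f xs := by
  choose y hy using hmax
  set xs : Stack n d := WithLp.toLp 2 y
  have hxs : ∀ i, IsConjMaximizer (f i) (ws i) (xs i) := hy
  have hdom := mem_domain_of_isConjMaximizer hbot hD hxs
  have hdual := dualObj_eq_inner_sub hbot hD hxs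
  have hK := (isConjOn_dualObj hD).gradient_mem_orthogonal hμ (strongConvexOn_realObj hconv) hws
    hmin
  rw [(isConjOn_dualObj hD).gradient_eq hμ (strongConvexOn_realObj hconv) hdom hdual] at hK
  rw [Submodule.inner_right_of_mem_orthogonal hws hK, zero_sub] at hdual
  have hsol : IsPrimalSolution f xs := (isPrimalSolution_iff hbot hF).2
    ⟨hdom, coe_dualSubspace_orthogonal (n := n) (d := d) ▸ hK, by linarith⟩
  exact ⟨xs, hsol, fun xs' hxs' => (hxs'.gradient_dualObj_eq hμ hconv hD hbot hws hF).symm.trans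
    (hsol.gradient_dualObj_eq hμ hconv hD hbot hws hF)⟩

end Optimum

end FDGMAA

end

open FDGMAA in
theorem theorem1_general {n d : ℕ}
    (f : Fin n → Vec d → EReal) (hbot : ∀ i x, f i x ≠ ⊥)
    (μ : ℝ) (hμ : 0 < μ)
    (hconv : ∀ i, StrongConvexOn (dom (f i)) μ (fun x => (f i x).toReal))
    (hint : (interior (⋂ i, dom (f i))).Nonempty)
    (G : ℕ → SimpleGraph (Fin n)) (B : ℕ) (hB : 0 < B)
    (hconn : ∀ t, (unionGraph G B (t * B)).Connected)
    (h : ℕ → Fin n → Fin n → ℝ)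
    (hsymm : ∀ k i j, (G k).Adj i j → h k i j = h k j i)
    (hpos : ∃ c > 0, ∀ k i j, (G k).Adj i j → c ≤ h k i j)
    (hsum : ∀ k i, ∑ j ∈ nbrs (G k) i, h k i j ≤ 1)
    (L : ℝ) (hL : L = 1 / μ) (θ₁ θ₂ : ℝ) (hθ₁ : 0 < θ₁) (hθ₂ : 0 < θ₂)
    (w x : ℕ → Stack n d) (hrun : IsSafeGuardedRun f G h L θ₁ θ₂ w x) :
    (∀ i v, conj (f i) v = (dual (f i) v : EReal)) ∧
    IsLeast (dualObj f '' dualFeasible n d) (dualValue f) ∧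
    IsCompact (sublevel f (w 0)) ∧
    (primalValue f = ((primalValue f).toReal : EReal)) ∧
    (∀ k, primalObj f (x k) = ((primalObj f (x k)).toReal : EReal)) ∧
    (∀ k : ℕ, dualObj f (w k) - dualValue f ≤
      rateConst G h B L θ₁ θ₂ * radius f (w 0) ^ 2 *
          (dualObj f (w 0) - dualValue f) /
        (rateConst G h B L θ₁ θ₂ * radius f (w 0) ^ 2 +
          lapInf G B * ((k / B : ℕ) : ℝ) *
            (dualObj f (w 0) - dualValue f))) ∧
    (fun k : ℕ => dualObj f (w k) - dualValue f)
      =O[Filter.atTop] (fun k : ℕ => 1 / (k : ℝ)) ∧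
    ((∀ i v, ∃ y, IsConjMaximizer (f i) v y) → ∃! xs, IsPrimalSolution f xs) ∧
    (∀ xs, IsPrimalSolution f xs →
      (∀ k, ‖x k - xs‖ ≤
        Real.sqrt (2 * L * (dualObj f (w k) - dualValue f))) ∧
      (fun k : ℕ => ‖x k - xs‖) =O[Filter.atTop] (fun k : ℕ => 1 / Real.sqrt (k : ℝ))) ∧
    (∀ k, |(primalObj f (x k)).toReal - (primalValue f).toReal| ≤
      (radius f (w 0) + ‖w 0‖) *
        Real.sqrt (2 * L * (dualObj f (w k) - dualValue f))) ∧
    (fun k : ℕ => (primalObj f (x k)).toReal - (primalValue f).toReal)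
      =O[Filter.atTop] (fun k : ℕ => 1 / Real.sqrt (k : ℝ)) := by
  subst hL
  have hne (i) : (dom (f i)).Nonempty := (hint.mono interior_subset).mono (Set.iInter_subset _ i)
  have hD (i) := isConjOn_dual (hbot i) hμ (hconv i) (hne i) (hrun.primal 0 i)
  obtain ⟨ws, hws, hmin, hF⟩ := exists_isMinOn_dualObj hμ hconv hD hint
  obtain ⟨hvalue, hleast⟩ := isLeast_dualValue hws hmin
  have hS := isCompact_sublevel hμ hconv hD hint (w 0)
  have hfeas := hrun.mem_dualSubspace hsymm
  have hanti := hrun.antitone_dualObj hμ hconv hD hpos hsymm hsum hθ₂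
  have hwS (k) : w k ∈ sublevel f (w 0) := ⟨hanti k.zero_le, hfeas k⟩
  have hwsS : ws ∈ sublevel f (w 0) := ⟨hmin (hfeas 0), hws⟩
  have hR (k) := norm_sub_le_radius hS (hwS k) hwsS
  have hrate := hrun.isBigO_dualObj_sub hμ hconv hD hpos hsymm hsum hθ₂ hθ₁ hbot hconn hws hmin
    hR hB
  have hdist (xs) (hxs : IsPrimalSolution f xs) (k) :=
    hxs.norm_sub_le_sqrt hμ hconv hD hbot hws hF hmin (hfeas k) (hrun.primal k)
  have hobj (k) := abs_toReal_primalObj_sub_le hμ hconv hD hbot hws hF hmin (hfeas k)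
    (hrun.primal k) (norm_le_radius_add hS (hfeas 0) (hwS k))
    (norm_le_radius_add hS (hfeas 0) hwsS)
  rw [← hvalue] at hrate hobj
  simp only [← hvalue] at hdist
  refine ⟨fun i => (hD i).conj_eq_coe_dual (hbot i), hleast, hS, ?_, fun k => ?_, ?_, hrate,
    fun hmax => existsUnique_isPrimalSolution hμ hconv hD hbot hws hF hmin fun i => hmax i _,
    fun xs hxs => ⟨hdist xs hxs, isBigO_one_div_sqrt_of_le_mul_sqrt hrate
      fun k => (norm_norm _).trans_le ((hdist xs hxs k).trans_eq (one_mul _).symm)⟩,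
    hobj, isBigO_one_div_sqrt_of_le_mul_sqrt hrate hobj⟩
  · rw [primalValue_eq_coe_of_isGLB hbot hF, EReal.toReal_coe]
  · rw [primalObj_eq_coe_realObj hbot (mem_domain_of_isConjMaximizer hbot hD (hrun.primal k)),
      EReal.toReal_coe]
  · rw [hvalue]
    exact hrun.dualObj_sub_le hμ hconv hD hpos hsymm hsum hθ₂ hθ₁ hbot hconn hws hmin hR

theorem theorem1 {n d : ℕ}
    (f : Fin n → FDGMAA.Vec d → EReal) (hbot : ∀ i x, f i x ≠ ⊥)
    (μ : ℝ) (hμ : 0 < μ)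
    (hconv : ∀ i, StrongConvexOn (FDGMAA.dom (f i)) μ (fun x => (f i x).toReal))
    (hint : (interior (⋂ i, FDGMAA.dom (f i))).Nonempty)
    (G : ℕ → SimpleGraph (Fin n)) (B : ℕ) (hB : 0 < B)
    (hconn : ∀ k, (FDGMAA.unionGraph G B k).Connected)
    (h : ℕ → Fin n → Fin n → ℝ)
    (hsymm : ∀ k i j, (G k).Adj i j → h k i j = h k j i)
    (hpos : ∃ c > 0, ∀ k i j, (G k).Adj i j → c ≤ h k i j)
    (hsum : ∀ k i, ∑ j ∈ FDGMAA.nbrs (G k) i, h k i j ≤ 1)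
    (L : ℝ) (hL : L = 1 / μ) (β : ℝ) (hβ : β ∈ Set.Ioo 0 (1 / L))
    (c₁ c₂ : ℝ) (hc₁ : 0 < c₁) (hc₂ : 0 < c₂) (m : ℕ) (hm : 0 < m)
    (w x : ℕ → FDGMAA.Stack n d)
    (hrun : FDGMAA.IsRun f G h β L c₁ c₂ m w x) :
    -- the quantities in the bounds are genuine: `D` is finite, `D⋆` is attained, `S₀` is compact,
    -- `F⋆` and `F(x^k)` are finite
    (∀ i v, FDGMAA.conj (f i) v = (FDGMAA.dual (f i) v : EReal)) ∧
    IsLeast (FDGMAA.dualObj f '' FDGMAA.dualFeasible n d) (FDGMAA.dualValue f) ∧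
    IsCompact (FDGMAA.sublevel f (w 0)) ∧
    (FDGMAA.primalValue f = ((FDGMAA.primalValue f).toReal : EReal)) ∧
    (∀ k, FDGMAA.primalObj f (x k) = ((FDGMAA.primalObj f (x k)).toReal : EReal)) ∧
    -- dual error
    (∀ k : ℕ, FDGMAA.dualObj f (w k) - FDGMAA.dualValue f ≤
      FDGMAA.tau G h B β L c₁ c₂ * FDGMAA.radius f (w 0) ^ 2 *
          (FDGMAA.dualObj f (w 0) - FDGMAA.dualValue f) /
        (FDGMAA.tau G h B β L c₁ c₂ * FDGMAA.radius f (w 0) ^ 2 +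
          FDGMAA.lapInf G B * ((k / B : ℕ) : ℝ) *
            (FDGMAA.dualObj f (w 0) - FDGMAA.dualValue f))) ∧
    (fun k : ℕ => FDGMAA.dualObj f (w k) - FDGMAA.dualValue f)
      =O[Filter.atTop] (fun k : ℕ => 1 / (k : ℝ)) ∧
    -- there is exactly one primal solution, as soon as all the maxima that define the conjugates
    -- are attained (for instance when every `f i` is lower semicontinuous)
    ((∀ i v, ∃ y, FDGMAA.IsConjMaximizer (f i) v y) → ∃! xs, FDGMAA.IsPrimalSolution f xs) ∧
    -- distance to the primal solution
    (∀ xs, FDGMAA.IsPrimalSolution f xs →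
      (∀ k, ‖x k - xs‖ ≤
        Real.sqrt (2 * L * (FDGMAA.dualObj f (w k) - FDGMAA.dualValue f))) ∧
      (fun k : ℕ => ‖x k - xs‖) =O[Filter.atTop] (fun k : ℕ => 1 / Real.sqrt (k : ℝ))) ∧
    -- primal objective error
    (∀ k, |(FDGMAA.primalObj f (x k)).toReal - (FDGMAA.primalValue f).toReal| ≤
      (FDGMAA.radius f (w 0) + ‖w 0‖) *
        Real.sqrt (2 * L * (FDGMAA.dualObj f (w k) - FDGMAA.dualValue f))) ∧
    (fun k : ℕ => (FDGMAA.primalObj f (x k)).toReal - (FDGMAA.primalValue f).toReal)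
      =O[Filter.atTop] (fun k : ℕ => 1 / Real.sqrt (k : ℝ)) := by
  exact theorem1_general f hbot μ hμ hconv hint G B hB (fun t => hconn (t * B)) h hsymm hpos hsum L
    hL _ _ (FDGMAA.theta₁_pos (hL ▸ one_div_pos.2 hμ) hβ hc₁)
    (FDGMAA.theta₂_pos (hL ▸ one_div_pos.2 hμ) hβ hc₂) w x (hrun.isSafeGuardedRun hβ.1)
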